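/- Work in $\mathbb{R}^d$ and identify functions that agree almost everywhere. A generalized polyhedron is a finite union of convex polyhedra (finite intersections of closed half-spaces). The tangent cone of a convex polyhedron $Q$ at $v$ is $\{v+x : v+\varepsilon x\in Q \text{ for some } \varepsilon>0\}$ if $v\in Q$ and $\emptyset$ if $v\notin Q$; the tangent cone $\mathrm{tcone}(P,v)$ of a finite union $P=\bigcup_i Q_i$ is $\bigcup_i \mathrm{tcone}(Q_i,v)$. A line-cone is a (polyhedral, not necessarily convex) cone that is a union of parallel lines. A point $v\in P$ is an algebraic vertex of a generalized polyhedron $P$ if the indicator function $[\mathrm{tcone}(P,v)]$ is not almost everywhere equal to a finite real linear combination of indicator functions of line-cones. The Fourier–Laplace transform of a simplicial cone $K=v+\mathrm{pos}\{w_1,\dots,w_d\}$ ($w_1,\dots,w_d$ linearly independent) is the meromorphic function on $\mathbb{C}^d$ which continues $z\mapsto\int_K e^{\langle z,x\rangle}\,dx$, that is, $$\widehat{[K]}(z)=e^{\langle z,v\rangle}\,\frac{|\det(w_1,\dots,w_d)|}{\prod_{j=1}^d(-\langle z,w_j\rangle)}.$$ It is extended by linearity to all finite real linear combinations of indicator functions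 of simplicial cones. A polyconical function is a finite real linear combination of indicator functions of simplicial cones with apex at the origin. Theorem. (1) Every polyconical function $g$ has a Fourier–Laplace transform $\widehat g$ that does not depend on the representation of $g$, and $\widehat g=0$ if and only if $g$ is almost everywhere equal to a finite real linear combination of indicator functions of line-cones. (2) Consequently, for every generalized polyhedron $P\subset\mathbb{R}^d$ and every $v\in\mathbb{R}^d$, the function $[\mathrm{tcone}(P,v)]$ has a well-defined Fourier–Laplace transform, and $v$ is an algebraic vertex of $P$ if and only if this transform is not identically zero. -/

import Mathlib

open MeasureTheory Set

/-- A convex polyhedron in `ℝ^d`: the intersection of finitely many closed half-spaces. -/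
def IsPolyhedron {d : ℕ} (P : Set (EuclideanSpace ℝ (Fin d))) : Prop :=
  ∃ (m : ℕ) (a : Fin m → EuclideanSpace ℝ (Fin d)) (b : Fin m → ℝ),
    (∀ i, a i ≠ 0) ∧ P = {x | ∀ i, inner ℝ (a i) x ≤ b i}

/-- A generalized polyhedron: a finite union of convex polyhedra. -/
def IsGeneralizedPolyhedron {d : ℕ} (P : Set (EuclideanSpace ℝ (Fin d))) : Prop :=
  ∃ (n : ℕ) (Q : Fin n → Set (EuclideanSpace ℝ (Fin d))),
    (∀ i, IsPolyhedron (Q i)) ∧ P = ⋃ i, Q i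

/-- The tangent cone of `P` at `v`: the union of all rays from `v` that run inside `P` near `v`.
For a convex polyhedron this is `{v + x | v + ε x ∈ P for some ε > 0}` if `v ∈ P`, and `∅` if
`v ∉ P` (`mem_tangentCone_iff`); for a finite union of convex polyhedra it is the union of
their tangent cones (`tangentCone_iUnion`). -/
def tangentCone {d : ℕ} (P : Set (EuclideanSpace ℝ (Fin d))) (v : EuclideanSpace ℝ (Fin d)) :
    Set (EuclideanSpace ℝ (Fin d)) :=
  {y | ∃ ε : ℝ, 0 < ε ∧ ∀ t ∈ Icc 0 ε, v + t • (y - v) ∈ P}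

/-- A line-cone: a polyhedral (not necessarily convex) cone, with some apex `p`, that is a union
of parallel lines. -/
def IsLineCone {d : ℕ} (D : Set (EuclideanSpace ℝ (Fin d))) : Prop :=
  IsGeneralizedPolyhedron D ∧
  (∃ p : EuclideanSpace ℝ (Fin d), ∀ x ∈ D, ∀ t : ℝ, 0 ≤ t → p + t • (x - p) ∈ D) ∧
  ∃ u : EuclideanSpace ℝ (Fin d), u ≠ 0 ∧ ∀ x ∈ D, ∀ s : ℝ, x + s • u ∈ D

/-- `f` is, almost everywhere, a real linear combination of indicator functions of line-cones. -/
def IsLineConeCombination {d : ℕ} (f : EuclideanSpace ℝ (Fin d) → ℝ) : Prop :=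
  ∃ (n : ℕ) (α : Fin n → ℝ) (D : Fin n → Set (EuclideanSpace ℝ (Fin d))),
    (∀ i, IsLineCone (D i)) ∧
    f =ᵐ[volume] fun x => ∑ i, α i * (D i).indicator (fun _ => (1 : ℝ)) x

/-- `v` is an algebraic vertex of the generalized polyhedron `P`: the indicator function of the
tangent cone is not (up to a null set) a linear combination of line-cones. -/
def IsAlgebraicVertex {d : ℕ} (P : Set (EuclideanSpace ℝ (Fin d)))
    (v : EuclideanSpace ℝ (Fin d)) : Prop :=
  v ∈ P ∧ ¬ IsLineConeCombination ((tangentCone P v).indicator (fun _ => (1 : ℝ)))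

/-- The cone `v + pos {w_1, …, w_d}`; it is a simplicial cone when the `w_j` are linearly
independent. -/
def simplicialCone {d : ℕ} (v : EuclideanSpace ℝ (Fin d))
    (w : Fin d → EuclideanSpace ℝ (Fin d)) : Set (EuclideanSpace ℝ (Fin d)) :=
  {x | ∃ c : Fin d → ℝ, (∀ j, 0 ≤ c j) ∧ x = v + ∑ j, c j • w j}

/-- A polyconical function: almost everywhere a real linear combination of indicator functions of
simplicial cones with apex at the origin. -/
def IsPolyconical {d : ℕ} (g : EuclideanSpace ℝ (Fin d) → ℝ) : Prop :=
  ∃ (n : ℕ) (α : Fin n → ℝ) (w : Fin n → Fin d → EuclideanSpace ℝ (Fin d)),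
    (∀ i, LinearIndependent ℝ (w i)) ∧
    g =ᵐ[volume] fun x => ∑ i, α i * (simplicialCone 0 (w i)).indicator (fun _ => (1 : ℝ)) x

/-- The complex bilinear pairing `⟨z, x⟩ = ∑ z_j x_j` of `z ∈ ℂ^d` and `x ∈ ℝ^d`. -/
def pairing {d : ℕ} (z : Fin d → ℂ) (x : EuclideanSpace ℝ (Fin d)) : ℂ :=
  ∑ j, z j * (x j : ℂ)

/-- The Fourier–Laplace transform of the simplicial cone `v + pos {w_1, …, w_d}`: the meromorphic
function `e^{⟨z, v⟩} |det (w_1, …, w_d)| / ∏ (-⟨z, w_j⟩)` of `z ∈ ℂ^d`. It is the continuation of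
the integral of `e^{⟨z, x⟩}` over the cone, which converges when `Re ⟨z, w_j⟩ < 0` for all `j`
(`integrableOn_simplicialCone`, `integral_simplicialCone`). -/
noncomputable def simplicialConeTransform {d : ℕ} (v : EuclideanSpace ℝ (Fin d))
    (w : Fin d → EuclideanSpace ℝ (Fin d)) (z : Fin d → ℂ) : ℂ :=
  Complex.exp (pairing z v) * ((|Matrix.det (Matrix.of fun i j => w j i)| : ℝ) : ℂ) /
    ∏ j, (-pairing z (w j))

/-- `F` is the Fourier–Laplace transform of `f`. It is defined on the algebra of polyhedra, which
modulo null sets is the linear span of the indicator functions of the simplicial cones with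
arbitrary apices, by linear extension from simplicial cones. The transform is a meromorphic
function on `ℂ^d`, and two such functions are identified when they agree off a null set (the
formula has no meaning on the finitely many hyperplanes `⟨z, w_j⟩ = 0`). -/
def HasFourierLaplaceTransform {d : ℕ} (f : EuclideanSpace ℝ (Fin d) → ℝ)
    (F : (Fin d → ℂ) → ℂ) : Prop :=
  ∃ (n : ℕ) (α : Fin n → ℝ) (v : Fin n → EuclideanSpace ℝ (Fin d))
    (w : Fin n → Fin d → EuclideanSpace ℝ (Fin d)),
    (∀ i, LinearIndependent ℝ (w i)) ∧
    (f =ᵐ[volume] fun x =>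
      ∑ i, α i * (simplicialCone (v i) (w i)).indicator (fun _ => (1 : ℝ)) x) ∧
    F =ᵐ[volume] fun z => ∑ i, (α i : ℂ) * simplicialConeTransform (v i) (w i) z

theorem IsPolyhedron.isClosed {d : ℕ} {P : Set (EuclideanSpace ℝ (Fin d))}
    (hP : IsPolyhedron P) : IsClosed P := by
  obtain ⟨m, a, b, -, rfl⟩ := hP
  simp only [Set.ofPred_forall]
  exact isClosed_iInter fun i => isClosed_le (by fun_prop) continuous_const

theorem IsPolyhedron.convex {d : ℕ} {P : Set (EuclideanSpace ℝ (Fin d))}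
    (hP : IsPolyhedron P) : Convex ℝ P := by
  obtain ⟨m, a, b, -, rfl⟩ := hP
  simp only [Set.ofPred_forall]
  exact convex_iInter fun i => convex_halfSpace_le (innerₛₗ ℝ (a i)).isLinear (b i)

theorem mem_tangentCone_iff {d : ℕ} {P : Set (EuclideanSpace ℝ (Fin d))} (hP : IsPolyhedron P)
    (v y : EuclideanSpace ℝ (Fin d)) :
    y ∈ tangentCone P v ↔ v ∈ P ∧ ∃ ε : ℝ, 0 < ε ∧ v + ε • (y - v) ∈ P := by
  constructor
  · rintro ⟨ε, hε, h⟩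
    exact ⟨by simpa using h 0 ⟨le_rfl, hε.le⟩, ε, hε, h ε ⟨hε.le, le_rfl⟩⟩
  · rintro ⟨hv, ε, hε, h⟩
    refine ⟨ε, hε, fun t ht => ?_⟩
    have := hP.convex hv h (a := 1 - t / ε) (b := t / ε)
      (by rw [sub_nonneg, div_le_one hε]; exact ht.2) (div_nonneg ht.1 hε.le) (by ring)
    convert! this using 1
    rw [smul_add, smul_smul, div_mul_cancel₀ _ hε.ne', ← add_assoc, ← add_smul]
    simp

theorem tangentCone_iUnion {d n : ℕ} {Q : Fin n → Set (EuclideanSpace ℝ (Fin d))}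
    (hQ : ∀ i, IsPolyhedron (Q i)) (v : EuclideanSpace ℝ (Fin d)) :
    tangentCone (⋃ i, Q i) v = ⋃ i, tangentCone (Q i) v := by
  ext y
  rw [mem_iUnion]
  constructor
  · rintro ⟨ε, hε, h⟩
    by_contra! hn
    have key : ∀ i, ∃ δ : ℝ, 0 < δ ∧ ∀ t ∈ Ioo 0 δ, v + t • (y - v) ∉ Q i := by
      intro i
      by_contra! hc
      refine hn i ((mem_tangentCone_iff (hQ i) v y).2 ⟨?_, ?_⟩)
      · rw [← (hQ i).isClosed.closure_eq, Metric.mem_closure_iff]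
        intro r hr
        obtain ⟨t, ht, hm⟩ := hc (r / (‖y - v‖ + 1)) (by positivity)
        refine ⟨_, hm, ?_⟩
        rw [dist_self_add_right, norm_smul, Real.norm_of_nonneg ht.1.le]
        have h1 : t * (‖y - v‖ + 1) < r := (lt_div_iff₀ (by positivity)).1 ht.2
        nlinarith [ht.1, norm_nonneg (y - v)]
      · obtain ⟨t, ht, hm⟩ := hc 1 one_pos
        exact ⟨t, ht.1, hm⟩
    choose δ hδ hδ' using key
    obtain ⟨t, ht0, ht⟩ : ∃ t : ℝ, 0 < t ∧ t ≤ ε ∧ ∀ i, t < δ i := by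
      have h1 : ∀ᶠ t in nhdsWithin (0 : ℝ) (Ioi 0), t ∈ Ioi (0 : ℝ) := self_mem_nhdsWithin
      have h2 : ∀ᶠ t in nhdsWithin (0 : ℝ) (Ioi 0), t ≤ ε :=
        nhdsWithin_le_nhds (Iic_mem_nhds hε)
      have h3 : ∀ᶠ t in nhdsWithin (0 : ℝ) (Ioi 0), ∀ i, t < δ i :=
        Filter.eventually_all.2 fun i => nhdsWithin_le_nhds (Iio_mem_nhds (hδ i))
      obtain ⟨t, a, b, c⟩ := (h1.and (h2.and h3)).exists
      exact ⟨t, a, b, c⟩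
    obtain ⟨i, hi⟩ := mem_iUnion.1 (h t ⟨ht0.le, ht.1⟩)
    exact hδ' i t ⟨ht0, ht.2 i⟩ hi
  · rintro ⟨i, ε, hε, h⟩
    exact ⟨ε, hε, fun t ht => mem_iUnion.2 ⟨i, h t ht⟩⟩

theorem simplicialCone_eq_image {d : ℕ} (v : EuclideanSpace ℝ (Fin d))
    (w : Fin d → EuclideanSpace ℝ (Fin d)) :
    simplicialCone v w = (fun c : EuclideanSpace ℝ (Fin d) =>
      v + Matrix.toLpLin 2 2 (Matrix.of fun i j => w j i) c) '' {c | ∀ j, 0 ≤ c j} := by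
  have key : ∀ c : EuclideanSpace ℝ (Fin d),
      Matrix.toLpLin 2 2 (Matrix.of fun i j => w j i) c = ∑ j, c j • w j := by
    intro c
    ext i
    simp [Matrix.mulVec, dotProduct, mul_comm]
  ext x
  constructor
  · rintro ⟨c, hc, rfl⟩
    exact ⟨WithLp.toLp 2 c, hc, by simp only [key]⟩
  · rintro ⟨c, hc, rfl⟩
    exact ⟨c, hc, by simp only [key]⟩

theorem pairing_add_sum {d : ℕ} (z : Fin d → ℂ) (v : EuclideanSpace ℝ (Fin d))
    (w : Fin d → EuclideanSpace ℝ (Fin d)) (c : Fin d → ℝ) :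
    pairing z (v + Matrix.toLpLin 2 2 (Matrix.of fun i j => w j i) (WithLp.toLp 2 c)) =
      pairing z v + ∑ j, pairing z (w j) * (c j : ℂ) := by
  simp only [pairing, PiLp.add_apply, Complex.ofReal_add, mul_add, Finset.sum_add_distrib,
    Matrix.toLpLin_apply, Matrix.mulVec, dotProduct, Matrix.of_apply, Complex.ofReal_sum,
    Complex.ofReal_mul, Finset.mul_sum, Finset.sum_mul]
  congr 1
  rw [Finset.sum_comm]
  exact Finset.sum_congr rfl fun _ _ => Finset.sum_congr rfl fun _ _ => by ring

theorem simplicialCone_aux {d : ℕ} (v : EuclideanSpace ℝ (Fin d))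
    {w : Fin d → EuclideanSpace ℝ (Fin d)} (hw : LinearIndependent ℝ w) (z : Fin d → ℂ)
    (hz : ∀ j, (pairing z (w j)).re < 0) :
    IntegrableOn (fun x => Complex.exp (pairing z x)) (simplicialCone v w) ∧
    ∫ x in simplicialCone v w, Complex.exp (pairing z x) = simplicialConeTransform v w z := by
  set M : Matrix (Fin d) (Fin d) ℝ := Matrix.of fun i j => w j i with hM
  set A : EuclideanSpace ℝ (Fin d) →L[ℝ] EuclideanSpace ℝ (Fin d) :=
    LinearMap.toContinuousLinearMap (Matrix.toLpLin 2 2 M) with hA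
  have hdet : A.det = M.det := by
    rw [hA, ContinuousLinearMap.det]
    simp
  have hinj : Function.Injective A := by
    intro x y hxy
    have h0 : ∑ j, (x - y) j • w j = 0 := by
      have : A (x - y) = 0 := by rw [map_sub, hxy, sub_self]
      rw [← this]
      ext i
      simp [hA, hM, Matrix.mulVec, dotProduct, mul_comm, sub_mul,
        Finset.sum_sub_distrib]
    have := Fintype.linearIndependent_iff.1 hw _ h0
    ext j
    simpa [sub_eq_zero] using this j
  set S : Set (EuclideanSpace ℝ (Fin d)) := {c | ∀ j, 0 ≤ c j} with hS
  have hSm : MeasurableSet S := by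
    apply IsClosed.measurableSet
    simp only [hS, Set.ofPred_forall]
    exact isClosed_iInter fun j => isClosed_le continuous_const (by fun_prop)
  have himg : simplicialCone v w = (fun c => v + A c) '' S := simplicialCone_eq_image v w
  have hf' : ∀ x ∈ S, HasFDerivWithinAt (fun c => v + A c) A S x :=
    fun x _ => (A.hasFDerivAt.const_add v).hasFDerivWithinAt
  have hfi : InjOn (fun c => v + A c) S := fun x _ y _ h => hinj (add_left_cancel h)
  -- the integrand in the coordinates given by the generators
  set G : (Fin d → ℝ) → ℂ := fun c => ∏ j, Complex.exp (pairing z (w j) * (c j : ℂ)) with hG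
  have hexp : ∀ c : Fin d → ℝ, Complex.exp (pairing z (v + A (WithLp.toLp 2 c))) =
      Complex.exp (pairing z v) * G c := by
    intro c
    have := pairing_add_sum z v w c
    rw [show pairing z (v + A (WithLp.toLp 2 c)) = _ from this, Complex.exp_add,
      Complex.exp_sum]
  have hpre : (WithLp.toLp 2 : (Fin d → ℝ) → EuclideanSpace ℝ (Fin d)) ⁻¹' S =
      Set.univ.pi fun _ => Ici (0 : ℝ) := by
    ext c
    simp [hS, Set.mem_pi, -Set.pi_univ_Ici]
  have hme := (MeasurableEquiv.toLp 2 (Fin d → ℝ)).measurableEmbedding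
  have hmp := PiLp.volume_preserving_toLp (Fin d)
  have hres : (volume : Measure (Fin d → ℝ)).restrict (Set.univ.pi fun _ => Ici (0 : ℝ)) =
      Measure.pi fun _ => (volume : Measure ℝ).restrict (Ioi 0) := by
    rw [volume_pi, Measure.restrict_pi_pi]
    simp_rw [Measure.restrict_congr_set (Ioi_ae_eq_Ici (a := (0 : ℝ)) (μ := volume)).symm]
  have hGint : IntegrableOn G (Set.univ.pi fun _ => Ici (0 : ℝ)) := by
    rw [IntegrableOn, hres]
    exact Integrable.fintype_prod (f := fun j (t : ℝ) => Complex.exp (pairing z (w j) * (t : ℂ)))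
      fun j => integrableOn_exp_mul_complex_Ioi (hz j) 0
  have hGval : ∫ c in Set.univ.pi fun _ => Ici (0 : ℝ), G c = ∏ j, (-pairing z (w j))⁻¹ := by
    rw [hres, hG, integral_fintype_prod_eq_prod
      (f := fun j (t : ℝ) => Complex.exp (pairing z (w j) * (t : ℂ)))]
    refine Finset.prod_congr rfl fun j _ => ?_
    rw [integral_exp_mul_complex_Ioi (hz j)]
    rw [inv_neg]
    simp [neg_div]
  constructor
  · rw [himg, integrableOn_image_iff_integrableOn_abs_det_fderiv_smul volume hSm hf' hfi,
      ← hmp.integrableOn_comp_preimage hme, hpre]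
    refine Integrable.smul _ ?_
    simp only [hexp]
    exact hGint.const_mul _
  · rw [himg, integral_image_eq_integral_abs_det_fderiv_smul volume hSm hf' hfi,
      ← hmp.setIntegral_preimage_emb hme, hpre]
    simp only [hexp, integral_smul, integral_const_mul, hGval, hdet]
    rw [simplicialConeTransform, Complex.real_smul, Finset.prod_inv_distrib, div_eq_mul_inv]
    ring

/-- The defining integral of the Fourier–Laplace transform converges when `Re ⟨z, w_j⟩ < 0` for
all generators `w_j`. -/
theorem integrableOn_simplicialCone {d : ℕ} (v : EuclideanSpace ℝ (Fin d))
    {w : Fin d → EuclideanSpace ℝ (Fin d)} (hw : LinearIndependent ℝ w) (z : Fin d → ℂ)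
    (hz : ∀ j, (pairing z (w j)).re < 0) :
    IntegrableOn (fun x => Complex.exp (pairing z x)) (simplicialCone v w) :=
  (simplicialCone_aux v hw z hz).1

/-- Where it converges, the defining integral of the Fourier–Laplace transform of a simplicial
cone is `simplicialConeTransform`. -/
theorem integral_simplicialCone {d : ℕ} (v : EuclideanSpace ℝ (Fin d))
    {w : Fin d → EuclideanSpace ℝ (Fin d)} (hw : LinearIndependent ℝ w) (z : Fin d → ℂ)
    (hz : ∀ j, (pairing z (w j)).re < 0) :
    ∫ x in simplicialCone v w, Complex.exp (pairing z x) = simplicialConeTransform v w z :=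
  (simplicialCone_aux v hw z hz).2

/-! ### Null sets -/

/-! The difficulty is that the Laplace integrals of different simplicial cones need not converge at
any common point, so linear extension of the formula is not obviously consistent. The remedy is the
group algebra of `ℝ^d`, acting on functions by translations. Under the Laplace integral an element
`p` acts as multiplication by its character value at `z`. The product of the elements `1 - [w_j]`
turns the cone generated by the `w_j` into a half-open parallelepiped, whose integral converges for
every `z`. Dividing by the character value recovers the rational formula wherever no `e^{⟨z, w_j⟩}`
equals 1, hence off a null set (`hasGeneralizedLaplace_simplicialCone`). The value obtained does not
depend on `p`, because the group algebra is commutative (`HasGeneralizedLaplace.unique`). The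
transform therefore depends on the function alone.

A line-cone is invariant under some translation `u ≠ 0`, so its transform satisfies `F = e^{⟨z, u⟩}
F` and vanishes almost everywhere.

Conversely, reversing one generator changes the sign of a cone's indicator modulo a line-cone. For a
generic `ξ`, every combination `f` is thus congruent, modulo line-cones, to a combination `h` of
cones whose generators all have negative inner product with `ξ`
(`exists_simplicialCone_sub_isLineConeCombination`). If the transform of `f` vanishes, so does that
of `h`. The latter is an honest integral on a tube containing `ξ + iℝ^d`, and Fourier injectivity
for `h(x) e^{⟨ξ, x⟩}` gives `h = 0` almost everywhere
(`ae_eq_zero_of_ae_hasGeneralizedLaplace_zero`).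

For tangent cones it remains to see that a transform exists. The span of the simplicial cones with
apex `v` is stable under multiplication by indicators of half-spaces bounded by hyperplanes through
`v`, by edge subdivision. It is then stable under finite Boolean combinations of these, which
include the tangent cones. -/

theorem volume_setOf_linearMap_eq {G H : Type*} [NormedAddCommGroup G] [NormedSpace ℝ G]
    [MeasurableSpace G] [BorelSpace G] [FiniteDimensional ℝ G] (μ : Measure G)
    [μ.IsAddHaarMeasure] [AddCommGroup H] [Module ℝ H] {l : G →ₗ[ℝ] H} (hl : l ≠ 0) (c : H) :
    μ {x | l x = c} = 0 := by
  by_cases h : ∃ x₀, l x₀ = c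
  · obtain ⟨x₀, rfl⟩ := h
    have h0 : μ (LinearMap.ker l : Set G) = 0 :=
      Measure.addHaar_submodule μ _ (by rwa [Ne, LinearMap.ker_eq_top])
    rw [← measure_preimage_add_right μ (-x₀)] at h0
    convert h0 using 2
    ext x
    simp [sub_eq_zero, ← sub_eq_add_neg]
  · convert measure_empty (μ := μ)
    ext x
    simpa using fun hx => h ⟨x, hx⟩

theorem ae_linearMap_sub_ne {d : ℕ} {l : EuclideanSpace ℝ (Fin d) →ₗ[ℝ] ℝ} (hl : l ≠ 0)
    (v : EuclideanSpace ℝ (Fin d)) : ∀ᵐ x, l (x - v) ≠ 0 := by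
  rw [ae_iff]
  convert volume_setOf_linearMap_eq volume hl (l v) using 3
  simp [sub_eq_zero]

/-! ### Polyhedra -/

theorem isPolyhedron_of_finite {d : ℕ} {ι : Type*} [Finite ι] (a : ι → EuclideanSpace ℝ (Fin d))
    (b : ι → ℝ) (ha : ∀ i, a i ≠ 0) : IsPolyhedron {x | ∀ i, inner ℝ (a i) x ≤ b i} := by
  obtain ⟨n, ⟨e⟩⟩ := Finite.exists_equiv_fin ι
  refine ⟨n, a ∘ e.symm, b ∘ e.symm, fun i => ha _, ?_⟩
  ext x
  simpa using e.forall_congr_left (p := fun i => inner ℝ (a i) x ≤ b i)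

theorem IsPolyhedron.isGeneralizedPolyhedron {d : ℕ} {Q : Set (EuclideanSpace ℝ (Fin d))}
    (hQ : IsPolyhedron Q) : IsGeneralizedPolyhedron Q :=
  ⟨1, fun _ => Q, fun _ => hQ, (iUnion_const Q).symm⟩

/-! ### Cones spanned by a basis, with some coordinates left free -/

/-- The basis of `ℝ^d` given by `d` linearly independent vectors. -/
noncomputable def coneBasis {d : ℕ} {w : Fin d → EuclideanSpace ℝ (Fin d)}
    (hw : LinearIndependent ℝ w) : Module.Basis (Fin d) ℝ (EuclideanSpace ℝ (Fin d)) :=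
  Module.Basis.mk hw (hw.span_eq_top_of_card_eq_finrank' (by simp)).ge

theorem coneBasis_apply {d : ℕ} {w : Fin d → EuclideanSpace ℝ (Fin d)}
    (hw : LinearIndependent ℝ w) (j : Fin d) : coneBasis hw j = w j := by
  simp [coneBasis]

theorem coneBasis_repr_sum {d : ℕ} {w : Fin d → EuclideanSpace ℝ (Fin d)}
    (hw : LinearIndependent ℝ w) (c : Fin d → ℝ) (k : Fin d) :
    (coneBasis hw).repr (∑ j, c j • w j) k = c k := by
  simp_rw [← coneBasis_apply hw]
  rw [Module.Basis.repr_sum_self]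

theorem sum_coneBasis_repr {d : ℕ} {w : Fin d → EuclideanSpace ℝ (Fin d)}
    (hw : LinearIndependent ℝ w) (x : EuclideanSpace ℝ (Fin d)) :
    ∑ j, (coneBasis hw).repr x j • w j = x := by
  simp_rw [← coneBasis_apply hw]
  rw [Module.Basis.sum_repr]

theorem coneBasis_coord_ne_zero {d : ℕ} {w : Fin d → EuclideanSpace ℝ (Fin d)}
    (hw : LinearIndependent ℝ w) (j : Fin d) : (coneBasis hw).coord j ≠ 0 := by
  intro h
  have := congrArg (fun l => l (coneBasis hw j)) h
  simp at this

/-- The cone `v + pos {w_k : k ∉ J} + span {w_k : k ∈ J}`. -/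
def partialCone {d : ℕ} (v : EuclideanSpace ℝ (Fin d)) (w : Fin d → EuclideanSpace ℝ (Fin d))
    (J : Set (Fin d)) : Set (EuclideanSpace ℝ (Fin d)) :=
  {x | ∃ c : Fin d → ℝ, (∀ j ∉ J, 0 ≤ c j) ∧ x = v + ∑ j, c j • w j}

theorem partialCone_empty {d : ℕ} (v : EuclideanSpace ℝ (Fin d))
    (w : Fin d → EuclideanSpace ℝ (Fin d)) : partialCone v w ∅ = simplicialCone v w := by
  simp [partialCone, simplicialCone]

theorem mem_partialCone_iff {d : ℕ} (v : EuclideanSpace ℝ (Fin d))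
    {w : Fin d → EuclideanSpace ℝ (Fin d)} (hw : LinearIndependent ℝ w) (J : Set (Fin d))
    (x : EuclideanSpace ℝ (Fin d)) :
    x ∈ partialCone v w J ↔ ∀ j ∉ J, 0 ≤ (coneBasis hw).repr (x - v) j := by
  constructor
  · rintro ⟨c, hc, rfl⟩ j hj
    rw [add_sub_cancel_left, coneBasis_repr_sum]
    exact hc j hj
  · intro h
    exact ⟨_, h, by rw [sum_coneBasis_repr]; abel⟩

theorem mem_simplicialCone_iff {d : ℕ} (v : EuclideanSpace ℝ (Fin d))
    {w : Fin d → EuclideanSpace ℝ (Fin d)} (hw : LinearIndependent ℝ w)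
    (x : EuclideanSpace ℝ (Fin d)) :
    x ∈ simplicialCone v w ↔ ∀ j, 0 ≤ (coneBasis hw).repr (x - v) j := by
  rw [← partialCone_empty, mem_partialCone_iff v hw]
  simp

theorem partialCone_univ {d : ℕ} (v : EuclideanSpace ℝ (Fin d))
    {w : Fin d → EuclideanSpace ℝ (Fin d)} (hw : LinearIndependent ℝ w) :
    partialCone v w univ = univ := by
  ext x
  simp [mem_partialCone_iff v hw]

theorem LinearIndependent.update_neg {d : ℕ} {w : Fin d → EuclideanSpace ℝ (Fin d)}
    (hw : LinearIndependent ℝ w) (j : Fin d) :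
    LinearIndependent ℝ (Function.update w j (-w j)) := by
  convert hw.units_smul (fun k => if k = j then -1 else 1) using 1
  ext1 k
  by_cases h : k = j
  · subst h; simp
  · simp [h]

theorem mem_partialCone_update_neg {d : ℕ} (v : EuclideanSpace ℝ (Fin d))
    {w : Fin d → EuclideanSpace ℝ (Fin d)} (hw : LinearIndependent ℝ w) {J : Set (Fin d)}
    {j : Fin d} (hj : j ∉ J) (x : EuclideanSpace ℝ (Fin d)) :
    x ∈ partialCone v (Function.update w j (-w j)) J ↔
      x ∈ partialCone v w (insert j J) ∧ (coneBasis hw).repr (x - v) j ≤ 0 := by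
  have key : ∀ c : Fin d → ℝ, ∑ k, c k • (Function.update w j (-w j)) k =
      ∑ k, (Function.update c j (-c j)) k • w k := by
    intro c
    refine Finset.sum_congr rfl fun k _ => ?_
    by_cases h : k = j
    · subst h; simp
    · simp [h]
  rw [mem_partialCone_iff v hw]
  constructor
  · rintro ⟨c, hc, rfl⟩
    rw [key, add_sub_cancel_left]
    simp_rw [coneBasis_repr_sum]
    refine ⟨fun k hk => ?_, by simpa using hc j hj⟩
    rw [mem_insert_iff, not_or] at hk
    simpa [hk.1] using hc k hk.2
  · rintro ⟨h1, h2⟩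
    set c := (coneBasis hw).repr (x - v) with hc
    refine ⟨Function.update c j (-c j), fun k hk => ?_, ?_⟩
    · by_cases h : k = j
      · subst h; simpa using h2
      · simpa [h] using h1 k (by simp [h, hk])
    · rw [key]
      simp only [Function.update_self, neg_neg, Function.update_idem, Function.update_eq_self]
      rw [hc, sum_coneBasis_repr]
      abel

/-- The hyperplane where coordinate `j` vanishes cuts the larger cone into the two on the right.
They overlap only in this hyperplane, which is null. -/
theorem partialCone_insert_indicator {d : ℕ} (v : EuclideanSpace ℝ (Fin d))
    {w : Fin d → EuclideanSpace ℝ (Fin d)} (hw : LinearIndependent ℝ w) {J : Set (Fin d)}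
    {j : Fin d} (hj : j ∉ J) :
    (partialCone v w (insert j J)).indicator (fun _ => (1 : ℝ)) =ᵐ[volume]
      (partialCone v w J).indicator (fun _ => (1 : ℝ)) +
        (partialCone v (Function.update w j (-w j)) J).indicator (fun _ => (1 : ℝ)) := by
  filter_upwards [ae_linearMap_sub_ne (coneBasis_coord_ne_zero hw j) v] with x hx
  rw [Module.Basis.coord_apply] at hx
  have h1 : x ∈ partialCone v w J ↔
      x ∈ partialCone v w (insert j J) ∧ 0 ≤ (coneBasis hw).repr (x - v) j := by
    simp only [mem_partialCone_iff v hw]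
    constructor
    · exact fun h => ⟨fun k hk => h k fun hk' => hk (Or.inr hk'), h j hj⟩
    · rintro ⟨h, h'⟩ k hk
      by_cases hkj : k = j
      · exact hkj ▸ h'
      · exact h k (by simp [hkj, hk])
  have h2 := mem_partialCone_update_neg v hw hj x
  classical
  simp only [Pi.add_apply, indicator_apply, h1, h2]
  rcases lt_or_gt_of_ne hx with h | h <;> simp [h.le, h.not_ge, -map_sub]

theorem isLineCone_partialCone_singleton {d : ℕ} (v : EuclideanSpace ℝ (Fin d))
    {w : Fin d → EuclideanSpace ℝ (Fin d)} (hw : LinearIndependent ℝ w) (j : Fin d) :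
    IsLineCone (partialCone v w {j}) := by
  refine ⟨?_, ⟨v, ?_⟩, w j, hw.ne_zero j, ?_⟩
  · apply IsPolyhedron.isGeneralizedPolyhedron
    -- Outer normals: `a k` represents minus the `k`-th coordinate functional. Only the inequalities
    -- with `k ≠ j` are kept.
    let a : Fin d → EuclideanSpace ℝ (Fin d) := fun k =>
      (InnerProductSpace.toDual ℝ (EuclideanSpace ℝ (Fin d))).symm
        (LinearMap.toContinuousLinearMap (-(coneBasis hw).coord k))
    have ha : ∀ k x, inner ℝ (a k) x = -(coneBasis hw).repr x k := by
      intro k x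
      simp [a]
    convert isPolyhedron_of_finite (ι := {k // k ≠ j}) (fun k => a k)
      (fun k => inner ℝ (a k) v) ?_ using 1
    · ext x
      simp [mem_partialCone_iff v hw, ha]
    · intro k hk
      have := ha k (w k)
      rw [← coneBasis_apply hw, hk] at this
      simp at this
  · intro x hx t ht
    rw [mem_partialCone_iff v hw] at hx ⊢
    intro k hk
    simpa using mul_nonneg ht (hx k hk)
  · intro x hx s
    rw [mem_partialCone_iff v hw] at hx ⊢
    intro k hk
    have := hx k hk
    rw [show x + s • w j - v = (x - v) + s • w j by abel, map_add, map_smul,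
      ← coneBasis_apply hw j, Module.Basis.repr_self]
    have hk' : j ≠ k := fun h => hk h.symm
    simpa [hk'] using this

/-! ### Edge subdivision of simplicial cones -/

/-- Translates coordinates in the modified generators into coordinates in `w`, so that subdivided
cones can be compared inside the single basis `coneBasis hw`. -/
theorem sum_smul_update_comb {d : ℕ} (w : Fin d → EuclideanSpace ℝ (Fin d)) {i j : Fin d}
    (hij : i ≠ j) (α β : ℝ) (c : Fin d → ℝ) :
    ∑ k, c k • (Function.update w j (α • w i + β • w j)) k =
      ∑ k, (Function.update (Function.update c i (c i + α * c j)) j (β * c j)) k • w k := by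
  have h1 : ∀ k, c k • (Function.update w j (α • w i + β • w j)) k =
      c k • w k + (Pi.single j (c j • (α • w i + β • w j - w j)) : Fin d → _) k := by
    intro k
    by_cases h : k = j
    · subst h; simp [smul_sub]
    · simp [h]
  have h2 : ∀ k, (Function.update (Function.update c i (c i + α * c j)) j (β * c j)) k • w k =
      c k • w k + ((Pi.single i ((α * c j) • w i) : Fin d → _) k +
        (Pi.single j ((β * c j - c j) • w j) : Fin d → _) k) := by
    intro k
    by_cases h : k = j
    · subst h; simp [hij.symm, sub_smul]
    · by_cases h' : k = i
      · subst h'; simp [h, add_smul]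
      · simp [h, h']
  simp_rw [h1, h2, Finset.sum_add_distrib, Finset.sum_pi_single', Finset.mem_univ, if_true]
  module

theorem LinearIndependent.update_comb {d : ℕ} {w : Fin d → EuclideanSpace ℝ (Fin d)}
    (hw : LinearIndependent ℝ w) {i j : Fin d} (hij : i ≠ j) (α : ℝ) {β : ℝ} (hβ : β ≠ 0) :
    LinearIndependent ℝ (Function.update w j (α • w i + β • w j)) := by
  rw [Fintype.linearIndependent_iff] at hw ⊢
  intro c hc
  rw [sum_smul_update_comb w hij] at hc
  have h := hw _ hc
  have hj : c j = 0 := by simpa [hβ] using h j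
  intro k
  by_cases hk : k = j
  · exact hk ▸ hj
  · by_cases hk' : k = i
    · subst hk'
      simpa [hk, hj] using h k
    · simpa [hk, hk'] using h k

theorem mem_simplicialCone_update_comb {d : ℕ} (v : EuclideanSpace ℝ (Fin d))
    {w : Fin d → EuclideanSpace ℝ (Fin d)} (hw : LinearIndependent ℝ w) {i j : Fin d}
    (hij : i ≠ j) {α β : ℝ} (hα : 0 < α) (hβ : 0 < β) (x : EuclideanSpace ℝ (Fin d)) :
    x ∈ simplicialCone v (Function.update w j (α • w i + β • w j)) ↔
      x ∈ simplicialCone v w ∧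
        α * (coneBasis hw).repr (x - v) j ≤ β * (coneBasis hw).repr (x - v) i := by
  rw [mem_simplicialCone_iff v hw]
  constructor
  · rintro ⟨c, hc, rfl⟩
    rw [sum_smul_update_comb w hij, add_sub_cancel_left]
    simp_rw [coneBasis_repr_sum]
    refine ⟨fun k => ?_, ?_⟩
    · by_cases h : k = j
      · subst h; simpa using mul_nonneg hβ.le (hc k)
      · by_cases h' : k = i
        · subst h'; simpa [h] using add_nonneg (hc k) (mul_nonneg hα.le (hc j))
        · simpa [h, h'] using hc k
    · simp [hij]
      nlinarith [mul_nonneg hβ.le (hc i)]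
  · rintro ⟨h1, h2⟩
    set c := (coneBasis hw).repr (x - v) with hc
    refine ⟨Function.update (Function.update c i (c i - α * (c j / β))) j (c j / β),
      fun k => ?_, ?_⟩
    · by_cases h : k = j
      · subst h; simpa using div_nonneg (h1 k) hβ.le
      · by_cases h' : k = i
        · subst h'
          have : α * (c j / β) ≤ c k := by
            rw [← mul_div_assoc, div_le_iff₀ hβ]; linarith
          simpa [h] using this
        · simpa [h, h'] using h1 k
    · have : ∑ k, c k • w k = x - v := sum_coneBasis_repr hw _
      rw [sum_smul_update_comb w hij, ← sub_eq_iff_eq_add', ← this]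
      refine Finset.sum_congr rfl fun k _ => ?_
      congr 1
      by_cases h : k = j
      · subst h; simp [mul_div_cancel₀ _ hβ.ne']
      · by_cases h' : k = i
        · subst h'; simp [h]
        · simp [h, h']

/-- The new ray lies inside the two-dimensional face of `w i` and `w j`. The hyperplane through it
and the remaining generators splits the cone according to the sign of `α c_j - β c_i`; only this
null hyperplane is counted twice. -/
theorem simplicialCone_indicator_eq_add {d : ℕ} (v : EuclideanSpace ℝ (Fin d))
    {w : Fin d → EuclideanSpace ℝ (Fin d)} (hw : LinearIndependent ℝ w) {i j : Fin d}
    (hij : i ≠ j) {α β : ℝ} (hα : 0 < α) (hβ : 0 < β) :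
    (simplicialCone v w).indicator (fun _ => (1 : ℝ)) =ᵐ[volume]
      (simplicialCone v (Function.update w j (α • w i + β • w j))).indicator (fun _ => (1 : ℝ)) +
      (simplicialCone v (Function.update w i (α • w i + β • w j))).indicator
        (fun _ => (1 : ℝ)) := by
  have hl : α • (coneBasis hw).coord j - β • (coneBasis hw).coord i ≠ 0 := by
    intro h
    have := congrArg (fun l => l (coneBasis hw j)) h
    simp [hij.symm] at this
    exact hα.ne' this
  filter_upwards [ae_linearMap_sub_ne hl v] with x hx
  have h1 := mem_simplicialCone_update_comb v hw hij hα hβ x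
  have h2 := mem_simplicialCone_update_comb v hw hij.symm hβ hα x
  rw [add_comm (β • w j)] at h2
  have hx' : α * (coneBasis hw).repr (x - v) j ≠ β * (coneBasis hw).repr (x - v) i := by
    simpa [sub_eq_zero, -map_sub] using hx
  classical
  simp only [Pi.add_apply, indicator_apply, h1, h2]
  rcases lt_or_gt_of_ne hx' with h | h <;> simp [h.le, h.not_ge, -map_sub]

/-! ### The span of the simplicial cones with a given apex -/

/-- The functions that are, almost everywhere, linear combinations of indicator functions of
simplicial cones with apex `v`. -/
def coneSpan {d : ℕ} (v : EuclideanSpace ℝ (Fin d)) : Submodule ℝ (EuclideanSpace ℝ (Fin d) → ℝ) :=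
  Submodule.span ℝ {f | ∃ w : Fin d → EuclideanSpace ℝ (Fin d), LinearIndependent ℝ w ∧
    f =ᵐ[volume] (simplicialCone v w).indicator (fun _ => (1 : ℝ))}

/-- A null function `n` equals `(K + n) - K`, and both `K` and `K + n` are generators for any
simplicial cone indicator `K`. -/
theorem mem_coneSpan_of_ae_eq {d : ℕ} {v : EuclideanSpace ℝ (Fin d)}
    {f g : EuclideanSpace ℝ (Fin d) → ℝ} (hf : f ∈ coneSpan v) (h : g =ᵐ[volume] f) :
    g ∈ coneSpan v := by
  obtain ⟨w, hw⟩ : ∃ w : Fin d → EuclideanSpace ℝ (Fin d), LinearIndependent ℝ w :=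
    ⟨_, (EuclideanSpace.basisFun (Fin d) ℝ).toBasis.linearIndependent⟩
  set K := (simplicialCone v w).indicator (fun _ => (1 : ℝ))
  have h1 : K ∈ coneSpan v := Submodule.subset_span ⟨w, hw, Filter.EventuallyEq.rfl⟩
  have h2 : K + (g - f) ∈ coneSpan v := by
    refine Submodule.subset_span ⟨w, hw, ?_⟩
    filter_upwards [h] with x hx
    simp [hx, K]
  convert (coneSpan v).add_mem hf ((coneSpan v).sub_mem h2 h1) using 1
  abel

theorem partialCone_indicator_mem_coneSpan {d : ℕ} (v : EuclideanSpace ℝ (Fin d))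
    {w : Fin d → EuclideanSpace ℝ (Fin d)} (hw : LinearIndependent ℝ w) (J : Finset (Fin d)) :
    (partialCone v w J).indicator (fun _ => (1 : ℝ)) ∈ coneSpan v := by
  classical
  induction J using Finset.induction_on generalizing w with
  | empty =>
    rw [Finset.coe_empty, partialCone_empty]
    exact Submodule.subset_span ⟨w, hw, Filter.EventuallyEq.rfl⟩
  | insert j J hj ih =>
    rw [Finset.coe_insert]
    exact mem_coneSpan_of_ae_eq ((coneSpan v).add_mem (ih hw) (ih (hw.update_neg j)))
      (partialCone_insert_indicator v hw (by simpa using hj))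

/-- The whole space is the cone with every coordinate left free. -/
theorem one_mem_coneSpan {d : ℕ} (v : EuclideanSpace ℝ (Fin d)) :
    (fun _ => (1 : ℝ)) ∈ coneSpan v := by
  have hw := (EuclideanSpace.basisFun (Fin d) ℝ).toBasis.linearIndependent
  have := partialCone_indicator_mem_coneSpan v hw Finset.univ
  rwa [Finset.coe_univ, partialCone_univ v hw, indicator_univ] at this

/-- Induction on the number of generators off the hyperplane orthogonal to `a`. If two generators
lie strictly on opposite sides, subdividing where their face meets the hyperplane gives two cones
with fewer such generators. Otherwise the cone lies on one side, and the intersection is the whole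
cone or a null set. -/
theorem simplicialCone_inter_halfSpace_mem_coneSpan {d : ℕ} (v a : EuclideanSpace ℝ (Fin d))
    {w : Fin d → EuclideanSpace ℝ (Fin d)} (hw : LinearIndependent ℝ w) :
    {x | inner ℝ a (x - v) ≤ 0}.indicator
      ((simplicialCone v w).indicator (fun _ => (1 : ℝ))) ∈ coneSpan v := by
  induction hN : (Finset.univ.filter fun k => inner ℝ a (w k) ≠ 0).card using
    Nat.strong_induction_on generalizing w with
  | _ N ih =>
    by_cases hex : ∃ i j, 0 < inner ℝ a (w i) ∧ inner ℝ a (w j) < 0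
    · obtain ⟨i, j, hi, hj⟩ := hex
      have hij : i ≠ j := by rintro rfl; exact absurd hi hj.not_gt
      -- The weights are chosen so that `α • w i + β • w j` is orthogonal to `a`.
      set α := -inner ℝ a (w j) with hα
      set β := inner ℝ a (w i) with hβ
      have hα0 : 0 < α := by linarith
      have hu : inner ℝ a (α • w i + β • w j) = 0 := by
        rw [inner_add_right, inner_smul_right, inner_smul_right]
        linarith [mul_comm α β]
      have hcard : ∀ k, inner ℝ a (w k) ≠ 0 → (Finset.univ.filter fun l => inner ℝ a
          (Function.update w k (α • w i + β • w j) l) ≠ 0).card < N := by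
        intro k hk
        rw [← hN]
        refine Finset.card_lt_card ⟨fun l => ?_, fun h => ?_⟩
        · by_cases hlk : l = k
          · subst hlk; simp [hu]
          · simp [hlk]
        · have := h (show k ∈ _ by simpa using hk)
          simp [hu] at this
      have hj' : LinearIndependent ℝ (Function.update w j (α • w i + β • w j)) :=
        hw.update_comb hij α hi.ne'
      have hi' : LinearIndependent ℝ (Function.update w i (α • w i + β • w j)) := by
        rw [add_comm]
        exact hw.update_comb hij.symm β hα0.ne'
      refine mem_coneSpan_of_ae_eq ((coneSpan v).add_mem (ih _ (hcard j hj.ne) hj' rfl)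
        (ih _ (hcard i hi.ne') hi' rfl)) ?_
      rw [← indicator_add']
      exact (simplicialCone_indicator_eq_add v hw hij hα0 hi).indicator
    · have hmem : (simplicialCone v w).indicator (fun _ => (1 : ℝ)) ∈ coneSpan v :=
        Submodule.subset_span ⟨w, hw, Filter.EventuallyEq.rfl⟩
      have hinner : ∀ c : Fin d → ℝ, inner ℝ a (v + ∑ k, c k • w k - v) =
          ∑ k, c k * inner ℝ a (w k) := by
        intro c
        rw [add_sub_cancel_left, inner_sum]
        simp [inner_smul_right]
      by_cases hle : ∀ k, inner ℝ a (w k) ≤ 0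
      · convert hmem using 1
        rw [indicator_indicator, inter_eq_right.2]
        rintro x ⟨c, hc, rfl⟩
        rw [mem_ofPred_eq, hinner]
        exact Finset.sum_nonpos fun k _ => mul_nonpos_of_nonneg_of_nonpos (hc k) (hle k)
      · push Not at hle
        obtain ⟨i, hi⟩ := hle
        have hge : ∀ k, 0 ≤ inner ℝ a (w k) := by
          intro k
          by_contra! hk
          exact hex ⟨i, k, hi, hk⟩
        have ha : (innerₛₗ ℝ a : EuclideanSpace ℝ (Fin d) →ₗ[ℝ] ℝ) ≠ 0 := by
          intro h
          have := congrArg (fun l => l (w i)) h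
          simp at this
          exact hi.ne' this
        -- Every generator is on the nonnegative side, so the intersection lies in the bounding
        -- hyperplane.
        refine mem_coneSpan_of_ae_eq (coneSpan v).zero_mem ?_
        filter_upwards [ae_linearMap_sub_ne ha v] with x hx
        rw [indicator_indicator, Pi.zero_apply, indicator_of_notMem]
        rintro ⟨h1, c, hc, rfl⟩
        rw [mem_ofPred_eq] at h1
        refine hx (le_antisymm h1 ?_)
        change 0 ≤ inner ℝ a _
        rw [hinner]
        exact Finset.sum_nonneg fun k _ => mul_nonneg (hc k) (hge k)

/-- Multiplication by the indicator function of `A` preserves `coneSpan v`. -/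
def IsConeMultiplier {d : ℕ} (v : EuclideanSpace ℝ (Fin d))
    (A : Set (EuclideanSpace ℝ (Fin d))) : Prop :=
  ∀ f ∈ coneSpan v, A.indicator f ∈ coneSpan v

theorem isConeMultiplier_halfSpace {d : ℕ} (v a : EuclideanSpace ℝ (Fin d)) :
    IsConeMultiplier v {x | inner ℝ a (x - v) ≤ 0} := by
  intro f hf
  induction hf using Submodule.span_induction with
  | mem f hf =>
    obtain ⟨w, hw, hf⟩ := hf
    exact mem_coneSpan_of_ae_eq (simplicialCone_inter_halfSpace_mem_coneSpan v a hw)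
      hf.indicator
  | zero => simp
  | add f g _ _ hf hg => rw [indicator_add']; exact (coneSpan v).add_mem hf hg
  | smul c f _ hf => 
    convert (coneSpan v).smul_mem c hf using 1
    exact indicator_const_smul _ c f

namespace IsConeMultiplier

variable {d : ℕ} {v : EuclideanSpace ℝ (Fin d)}

theorem compl {A : Set (EuclideanSpace ℝ (Fin d))} (hA : IsConeMultiplier v A) :
    IsConeMultiplier v Aᶜ := by
  intro f hf
  rw [indicator_compl]
  exact (coneSpan v).sub_mem hf (hA f hf)

theorem inter {A B : Set (EuclideanSpace ℝ (Fin d))} (hA : IsConeMultiplier v A)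
    (hB : IsConeMultiplier v B) : IsConeMultiplier v (A ∩ B) := by
  intro f hf
  rw [← indicator_indicator]
  exact hA _ (hB f hf)

theorem univ : IsConeMultiplier v univ := fun f hf => by rwa [indicator_univ]

theorem iInter {ι : Type*} [Finite ι] {A : ι → Set (EuclideanSpace ℝ (Fin d))}
    (hA : ∀ i, IsConeMultiplier v (A i)) : IsConeMultiplier v (⋂ i, A i) := by
  classical
  cases nonempty_fintype ι
  have : ∀ s : Finset ι, IsConeMultiplier v (⋂ i ∈ s, A i) := by
    intro s
    induction s using Finset.induction_on with
    | empty => simpa using univ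
    | insert i s _ ih => rw [Finset.set_biInter_insert]; exact (hA i).inter ih
  simpa using this Finset.univ

theorem iUnion {ι : Type*} [Finite ι] {A : ι → Set (EuclideanSpace ℝ (Fin d))}
    (hA : ∀ i, IsConeMultiplier v (A i)) : IsConeMultiplier v (⋃ i, A i) := by
  rw [iUnion_eq_compl_iInter_compl]
  exact (iInter fun i => (hA i).compl).compl

end IsConeMultiplier

/-! ### Tangent cones -/

/-- Only the constraints active at `v` survive, since a strict inequality persists near `v`. The
surviving half-spaces have `v` on their boundary. -/
theorem IsPolyhedron.isConeMultiplier_tangentCone {d : ℕ} {Q : Set (EuclideanSpace ℝ (Fin d))}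
    (hQ : IsPolyhedron Q) (v : EuclideanSpace ℝ (Fin d)) :
    IsConeMultiplier v (tangentCone Q v) := by
  by_cases hv : v ∈ Q
  swap
  · have : tangentCone Q v = univᶜ := by
      ext y
      simp [mem_tangentCone_iff hQ, hv]
    rw [this]
    exact IsConeMultiplier.univ.compl
  have hQ' := hQ
  obtain ⟨m, a, b, -, rfl⟩ := hQ
  have : tangentCone {x | ∀ i, inner ℝ (a i) x ≤ b i} v =
      ⋂ i : {i // inner ℝ (a i) v = b i}, {x | inner ℝ (a i) (x - v) ≤ 0} := by
    ext y
    rw [mem_tangentCone_iff hQ', mem_iInter]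
    constructor
    · rintro ⟨-, ε, hε, h⟩ ⟨i, hi⟩
      have := h i
      rw [inner_add_right, inner_smul_right, hi] at this
      exact nonpos_of_mul_nonpos_right (by linarith) hε
    · intro h
      refine ⟨hv, ?_⟩
      have h1 : ∀ i, ∀ᶠ ε in nhdsWithin (0 : ℝ) (Ioi 0),
          inner ℝ (a i) (v + ε • (y - v)) ≤ b i := by
        intro i
        rcases (hv i).eq_or_lt with hi | hi
        · filter_upwards [self_mem_nhdsWithin] with ε hε
          rw [inner_add_right, inner_smul_right, hi]
          have := mul_nonpos_of_nonneg_of_nonpos (le_of_lt (mem_Ioi.1 hε)) (h ⟨i, hi⟩)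
          linarith
        · have hc : ContinuousAt (fun ε : ℝ => inner ℝ (a i) (v + ε • (y - v))) 0 := by fun_prop
          have := hc.eventually_le_const (u := b i) (by simpa using hi)
          exact nhdsWithin_le_nhds this
      obtain ⟨ε, hε, h2⟩ := (Filter.Eventually.and (self_mem_nhdsWithin (a := (0 : ℝ)) (s := Ioi 0))
        (Filter.eventually_all.2 h1)).exists
      exact ⟨ε, hε, h2⟩
  rw [this]
  exact IsConeMultiplier.iInter fun i => isConeMultiplier_halfSpace v _

theorem IsGeneralizedPolyhedron.tangentCone_indicator_mem_coneSpan {d : ℕ}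
    {P : Set (EuclideanSpace ℝ (Fin d))} (hP : IsGeneralizedPolyhedron P)
    (v : EuclideanSpace ℝ (Fin d)) :
    (tangentCone P v).indicator (fun _ => (1 : ℝ)) ∈ coneSpan v := by
  obtain ⟨n, Q, hQ, rfl⟩ := hP
  rw [tangentCone_iUnion hQ]
  exact IsConeMultiplier.iUnion (fun i => (hQ i).isConeMultiplier_tangentCone v) _
    (one_mem_coneSpan v)

/-- Lets the decomposition of tangent cones apply to line-cones, each viewed as its own tangent cone
at its apex. -/
theorem tangentCone_apex_eq_self {d : ℕ} {D : Set (EuclideanSpace ℝ (Fin d))}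
    {p : EuclideanSpace ℝ (Fin d)} (hp : ∀ x ∈ D, ∀ t : ℝ, 0 ≤ t → p + t • (x - p) ∈ D) :
    tangentCone D p = D := by
  ext y
  constructor
  · rintro ⟨ε, hε, h⟩
    have := hp _ (h ε ⟨hε.le, le_rfl⟩) ε⁻¹ (inv_nonneg.2 hε.le)
    rwa [add_sub_cancel_left, inv_smul_smul₀ hε.ne', add_sub_cancel] at this
  · exact fun hy => ⟨1, one_pos, fun t ht => hp y hy t ht.1⟩

/-! ### Linear combinations -/

theorem hasFourierLaplaceTransform_simplicialCone {d : ℕ} (v : EuclideanSpace ℝ (Fin d))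
    {w : Fin d → EuclideanSpace ℝ (Fin d)} (hw : LinearIndependent ℝ w) :
    HasFourierLaplaceTransform ((simplicialCone v w).indicator (fun _ => (1 : ℝ)))
      (simplicialConeTransform v w) :=
  ⟨1, fun _ => 1, fun _ => v, fun _ => w, fun _ => hw, by simp, by simp⟩

theorem hasFourierLaplaceTransform_zero {d : ℕ} :
    HasFourierLaplaceTransform (0 : EuclideanSpace ℝ (Fin d) → ℝ) 0 :=
  ⟨0, Fin.elim0, Fin.elim0, Fin.elim0, fun i => i.elim0, by simp; rfl, by simp; rfl⟩

namespace HasFourierLaplaceTransform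

variable {d : ℕ} {f g : EuclideanSpace ℝ (Fin d) → ℝ} {F G : (Fin d → ℂ) → ℂ}

theorem congr_ae (hf : HasFourierLaplaceTransform f F) (h : g =ᵐ[volume] f) :
    HasFourierLaplaceTransform g F := by
  obtain ⟨n, α, v, w, hw, h1, h2⟩ := hf
  exact ⟨n, α, v, w, hw, h.trans h1, h2⟩

theorem add (hf : HasFourierLaplaceTransform f F) (hg : HasFourierLaplaceTransform g G) :
    HasFourierLaplaceTransform (f + g) (F + G) := by
  obtain ⟨n, α, v, w, hw, h1, h2⟩ := hf
  obtain ⟨m, β, v', w', hw', h1', h2'⟩ := hg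
  refine ⟨n + m, Fin.append α β, Fin.append v v', Fin.append w w', fun i => ?_, ?_, ?_⟩
  · refine Fin.addCases (fun i => ?_) (fun i => ?_) i
    · simpa using hw i
    · simpa using hw' i
  · filter_upwards [h1, h1'] with x hx hx'
    simp [Fin.sum_univ_add, hx, hx']
  · filter_upwards [h2, h2'] with x hx hx'
    simp [Fin.sum_univ_add, hx, hx']

theorem smul (c : ℝ) (hf : HasFourierLaplaceTransform f F) :
    HasFourierLaplaceTransform (c • f) (fun z => (c : ℂ) * F z) := by
  obtain ⟨n, α, v, w, hw, h1, h2⟩ := hf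
  refine ⟨n, fun i => c * α i, v, w, hw, ?_, ?_⟩
  · filter_upwards [h1] with x hx
    simp [hx, Finset.mul_sum, mul_assoc]
  · filter_upwards [h2] with x hx
    simp [hx, Finset.mul_sum, mul_assoc]

end HasFourierLaplaceTransform

theorem exists_hasFourierLaplaceTransform_of_mem_coneSpan {d : ℕ} {v : EuclideanSpace ℝ (Fin d)}
    {f : EuclideanSpace ℝ (Fin d) → ℝ} (hf : f ∈ coneSpan v) :
    ∃ F, HasFourierLaplaceTransform f F := by
  induction hf using Submodule.span_induction with
  | mem f hf =>
    obtain ⟨w, hw, hf⟩ := hf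
    exact ⟨_, (hasFourierLaplaceTransform_simplicialCone v hw).congr_ae hf⟩
  | zero => exact ⟨_, hasFourierLaplaceTransform_zero⟩
  | add f g _ _ hf hg =>
    obtain ⟨F, hF⟩ := hf
    obtain ⟨G, hG⟩ := hg
    exact ⟨_, hF.add hG⟩
  | smul c f _ hf =>
    obtain ⟨F, hF⟩ := hf
    exact ⟨_, hF.smul c⟩

theorem IsLineCone.exists_hasFourierLaplaceTransform {d : ℕ}
    {D : Set (EuclideanSpace ℝ (Fin d))} (hD : IsLineCone D) :
    ∃ F, HasFourierLaplaceTransform (D.indicator (fun _ => (1 : ℝ))) F := by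
  obtain ⟨h1, ⟨p, hp⟩, -⟩ := hD
  have := h1.tangentCone_indicator_mem_coneSpan p
  rw [tangentCone_apex_eq_self hp] at this
  exact exists_hasFourierLaplaceTransform_of_mem_coneSpan this

namespace IsLineConeCombination

variable {d : ℕ} {f g : EuclideanSpace ℝ (Fin d) → ℝ}

theorem congr_ae (hf : IsLineConeCombination f) (h : g =ᵐ[volume] f) :
    IsLineConeCombination g := by
  obtain ⟨n, α, D, hD, h1⟩ := hf
  exact ⟨n, α, D, hD, h.trans h1⟩

theorem zero : IsLineConeCombination (0 : EuclideanSpace ℝ (Fin d) → ℝ) :=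
  ⟨0, Fin.elim0, Fin.elim0, fun i => i.elim0, by simp; rfl⟩

theorem add (hf : IsLineConeCombination f) (hg : IsLineConeCombination g) :
    IsLineConeCombination (f + g) := by
  obtain ⟨n, α, D, hD, h1⟩ := hf
  obtain ⟨m, β, D', hD', h1'⟩ := hg
  refine ⟨n + m, Fin.append α β, Fin.append D D', fun i => ?_, ?_⟩
  · refine Fin.addCases (fun i => ?_) (fun i => ?_) i
    · simpa using hD i
    · simpa using hD' i
  · filter_upwards [h1, h1'] with x hx hx'
    simp [Fin.sum_univ_add, hx, hx']

theorem smul (c : ℝ) (hf : IsLineConeCombination f) : IsLineConeCombination (c • f) := by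
  obtain ⟨n, α, D, hD, h1⟩ := hf
  refine ⟨n, fun i => c * α i, D, hD, ?_⟩
  filter_upwards [h1] with x hx
  simp [hx, Finset.mul_sum, mul_assoc]

theorem sum {ι : Type*} (s : Finset ι) {f : ι → EuclideanSpace ℝ (Fin d) → ℝ}
    (hf : ∀ i ∈ s, IsLineConeCombination (f i)) : IsLineConeCombination (∑ i ∈ s, f i) :=
  Finset.sum_induction _ _ (fun _ _ => add) zero hf

end IsLineConeCombination

theorem IsLineCone.isLineConeCombination {d : ℕ} {D : Set (EuclideanSpace ℝ (Fin d))}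
    (hD : IsLineCone D) : IsLineConeCombination (D.indicator (fun _ => (1 : ℝ))) :=
  ⟨1, fun _ => 1, fun _ => D, fun _ => hD, by simp⟩

/-! ### Reversing generators modulo line-cones -/

/-- The sum is almost everywhere the cone in which `w j` may be taken with either sign, and this
contains every line in direction `w j` through its points. -/
theorem isLineConeCombination_add_update_neg {d : ℕ} (v : EuclideanSpace ℝ (Fin d))
    {w : Fin d → EuclideanSpace ℝ (Fin d)} (hw : LinearIndependent ℝ w) (j : Fin d) :
    IsLineConeCombination ((simplicialCone v w).indicator (fun _ => (1 : ℝ)) +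
      (simplicialCone v (Function.update w j (-w j))).indicator (fun _ => (1 : ℝ))) := by
  have h := partialCone_insert_indicator v hw (notMem_empty j)
  rw [partialCone_empty, partialCone_empty, insert_empty_eq] at h
  exact (isLineCone_partialCone_singleton v hw j).isLineConeCombination.congr_ae h.symm

/-- Reverse the generators on the positive side of `ξ` one at a time; each reversal contributes a
factor `-1` to `ε`. -/
theorem exists_simplicialCone_sub_isLineConeCombination {d : ℕ} (ξ v : EuclideanSpace ℝ (Fin d))
    {w : Fin d → EuclideanSpace ℝ (Fin d)} (hw : LinearIndependent ℝ w)
    (hξ : ∀ j, inner ℝ ξ (w j) ≠ 0) :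
    ∃ (ε : ℝ) (w' : Fin d → EuclideanSpace ℝ (Fin d)), LinearIndependent ℝ w' ∧
      (∀ j, inner ℝ ξ (w' j) < 0) ∧
      IsLineConeCombination ((simplicialCone v w).indicator (fun _ => (1 : ℝ)) -
        ε • (simplicialCone v w').indicator (fun _ => (1 : ℝ))) := by
  induction hN : (Finset.univ.filter fun k => 0 < inner ℝ ξ (w k)).card generalizing w with
  | zero =>
    refine ⟨1, w, hw, fun j => ?_, by simpa using IsLineConeCombination.zero⟩
    rw [Finset.card_eq_zero, Finset.filter_eq_empty_iff] at hN
    exact lt_of_le_of_ne (not_lt.1 (hN (Finset.mem_univ j))) (hξ j)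
  | succ N ih =>
    obtain ⟨j, hj⟩ := Finset.card_pos.1 (lt_of_lt_of_eq N.succ_pos hN.symm)
    have hj' : 0 < inner ℝ ξ (w j) := by simpa using hj
    obtain ⟨ε, w', h1, h2, h3⟩ := ih (hw.update_neg j) (fun k => by
      by_cases h : k = j
      · subst h; simpa using hξ k
      · simpa [h] using hξ k) (by
      rw [← Nat.add_right_cancel_iff (n := 1), ← hN, ← Finset.card_erase_add_one hj]
      congr 2
      ext k
      by_cases h : k = j
      · subst h; simpa using hj'.le
      · simp [h])
    refine ⟨-ε, w', h1, h2, ?_⟩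
    -- With `K'` the cone after one reversal and `K''` the final one, `K + ε K'' = (K + K') - (K' -
    -- ε K'')`.
    convert (isLineConeCombination_add_update_neg v hw j).add (h3.smul (-1)) using 1
    module

/-! ### The action of translations -/

/-- Translation operators on functions. -/
def translationHom (d : ℕ) : Multiplicative (EuclideanSpace ℝ (Fin d)) →*
    Module.End ℝ (EuclideanSpace ℝ (Fin d) → ℝ) where
  toFun u := LinearMap.funLeft ℝ ℝ fun x => x - u.toAdd
  map_one' := by ext f x; simp [LinearMap.funLeft_apply]
  map_mul' u v := by
    ext f x
    simp only [LinearMap.funLeft_apply, Module.End.mul_apply, toAdd_mul]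
    congr 1
    abel

/-- The action of the group algebra of `ℝ^d` on functions by translations. -/
noncomputable def translationAction (d : ℕ) : AddMonoidAlgebra ℝ (EuclideanSpace ℝ (Fin d)) →ₐ[ℝ]
    Module.End ℝ (EuclideanSpace ℝ (Fin d) → ℝ) :=
  AddMonoidAlgebra.lift ℝ _ _ (translationHom d)

theorem pairing_add {d : ℕ} (z : Fin d → ℂ) (x y : EuclideanSpace ℝ (Fin d)) :
    pairing z (x + y) = pairing z x + pairing z y := by
  simp [pairing, mul_add, Finset.sum_add_distrib]

theorem pairing_zero {d : ℕ} (z : Fin d → ℂ) : pairing z 0 = 0 := by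
  simp [pairing]

/-- The character `u ↦ e^{⟨z, u⟩}` of the group algebra of `ℝ^d`. -/
noncomputable def expCharacter {d : ℕ} (z : Fin d → ℂ) :
    AddMonoidAlgebra ℝ (EuclideanSpace ℝ (Fin d)) →ₐ[ℝ] ℂ :=
  AddMonoidAlgebra.lift ℝ _ _
    { toFun := fun u => Complex.exp (pairing z u.toAdd)
      map_one' := by simp [pairing_zero]
      map_mul' := fun u v => by simp [pairing_add, Complex.exp_add] }

theorem translationAction_single {d : ℕ} (u : EuclideanSpace ℝ (Fin d)) (r : ℝ)
    (f : EuclideanSpace ℝ (Fin d) → ℝ) (x : EuclideanSpace ℝ (Fin d)) :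
    translationAction d (AddMonoidAlgebra.single u r) f x = r * f (x - u) := by
  simp [translationAction, translationHom, LinearMap.funLeft_apply]

theorem expCharacter_single {d : ℕ} (z : Fin d → ℂ) (u : EuclideanSpace ℝ (Fin d)) (r : ℝ) :
    expCharacter z (AddMonoidAlgebra.single u r) = r * Complex.exp (pairing z u) := by
  simp [expCharacter]

theorem translationAction_ae_eq_zero {d : ℕ}
    (p : AddMonoidAlgebra ℝ (EuclideanSpace ℝ (Fin d))) {f : EuclideanSpace ℝ (Fin d) → ℝ}
    (hf : f =ᵐ[volume] 0) : translationAction d p f =ᵐ[volume] 0 := by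
  induction p using AddMonoidAlgebra.induction_linear with
  | zero => simp
  | add p q hp hq =>
    filter_upwards [hp, hq] with x h1 h2
    simp [h1, h2]
  | single u r =>
    have := (measurePreserving_sub_right volume u).quasiMeasurePreserving.ae_eq_comp hf
    filter_upwards [this] with x hx
    simp only [Function.comp_apply, Pi.zero_apply] at hx
    simp [translationAction_single, hx]

theorem translationAction_congr_ae {d : ℕ}
    (p : AddMonoidAlgebra ℝ (EuclideanSpace ℝ (Fin d))) {f g : EuclideanSpace ℝ (Fin d) → ℝ}
    (h : f =ᵐ[volume] g) : translationAction d p f =ᵐ[volume] translationAction d p g := by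
  have := translationAction_ae_eq_zero p (f := f - g) (by
    filter_upwards [h] with x hx
    simp [hx])
  rw [map_sub] at this
  filter_upwards [this] with x hx
  simpa [sub_eq_zero] using hx

/-! ### Laplace integrals and their values after translation -/

/-- The value `c` at `z` of the two-sided Laplace transform of `f`, where convergence is absolute. -/
def HasLaplaceIntegral {d : ℕ} (f : EuclideanSpace ℝ (Fin d) → ℝ) (z : Fin d → ℂ) (c : ℂ) : Prop :=
  Integrable (fun x => (f x : ℂ) * Complex.exp (pairing z x)) ∧
    ∫ x, (f x : ℂ) * Complex.exp (pairing z x) = c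

theorem HasLaplaceIntegral.add {d : ℕ} {f g : EuclideanSpace ℝ (Fin d) → ℝ} {z : Fin d → ℂ}
    {a b : ℂ} (hf : HasLaplaceIntegral f z a) (hg : HasLaplaceIntegral g z b) :
    HasLaplaceIntegral (f + g) z (a + b) := by
  simp only [HasLaplaceIntegral, Pi.add_apply, Complex.ofReal_add, add_mul]
  exact ⟨hf.1.add hg.1, by rw [integral_add hf.1 hg.1, hf.2, hg.2]⟩

theorem HasLaplaceIntegral.congr_ae {d : ℕ} {f g : EuclideanSpace ℝ (Fin d) → ℝ} {z : Fin d → ℂ}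
    {a : ℂ} (hf : HasLaplaceIntegral f z a) (h : g =ᵐ[volume] f) : HasLaplaceIntegral g z a := by
  have : (fun x => (f x : ℂ) * Complex.exp (pairing z x)) =ᵐ[volume]
      fun x => (g x : ℂ) * Complex.exp (pairing z x) := by
    filter_upwards [h] with x hx
    rw [hx]
  exact ⟨hf.1.congr this, by rw [← hf.2, integral_congr_ae this]⟩

theorem HasLaplaceIntegral.zero {d : ℕ} (z : Fin d → ℂ) :
    HasLaplaceIntegral (0 : EuclideanSpace ℝ (Fin d) → ℝ) z 0 := by
  simp [HasLaplaceIntegral]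

theorem HasLaplaceIntegral.smul {d : ℕ} {f : EuclideanSpace ℝ (Fin d) → ℝ} {z : Fin d → ℂ}
    {a : ℂ} (hf : HasLaplaceIntegral f z a) (r : ℝ) : HasLaplaceIntegral (r • f) z (r * a) := by
  simp only [HasLaplaceIntegral, Pi.smul_apply, smul_eq_mul, Complex.ofReal_mul, mul_assoc]
  exact ⟨hf.1.const_mul _, by rw [integral_const_mul, hf.2]⟩

theorem HasLaplaceIntegral.sum {d : ℕ} {z : Fin d → ℂ} {ι : Type*} (s : Finset ι) {f : ι → EuclideanSpace ℝ (Fin d) → ℝ} {c : ι → ℂ}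
    (hf : ∀ i ∈ s, HasLaplaceIntegral (f i) z (c i)) :
    HasLaplaceIntegral (∑ i ∈ s, f i) z (∑ i ∈ s, c i) := by
  classical
  induction s using Finset.induction_on with
  | empty => simpa using HasLaplaceIntegral.zero z
  | insert i s hi ih =>
    rw [Finset.sum_insert hi, Finset.sum_insert hi]
    exact (hf i (Finset.mem_insert_self i s)).add
      (ih fun j hj => hf j (Finset.mem_insert_of_mem hj))

theorem HasLaplaceIntegral.translate {d : ℕ} {f : EuclideanSpace ℝ (Fin d) → ℝ} {z : Fin d → ℂ}
    {a : ℂ} (hf : HasLaplaceIntegral f z a) (u : EuclideanSpace ℝ (Fin d)) :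
    HasLaplaceIntegral (fun x => f (x - u)) z (Complex.exp (pairing z u) * a) := by
  have key : (fun x => (f (x - u) : ℂ) * Complex.exp (pairing z x)) =
      fun x => Complex.exp (pairing z u) *
        (fun y => (f y : ℂ) * Complex.exp (pairing z y)) (x - u) := by
    ext x
    have : pairing z x = pairing z u + pairing z (x - u) := by rw [← pairing_add]; congr 1; abel
    rw [this, Complex.exp_add]
    ring
  rw [HasLaplaceIntegral, key]
  exact ⟨(hf.1.comp_sub_right u).const_mul _, by
    rw [integral_const_mul,
      integral_sub_right_eq_self (fun y => (f y : ℂ) * Complex.exp (pairing z y)), hf.2]⟩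

/-- Translation by `u` multiplies the integral by `e^{⟨z, u⟩}`; the general case follows by
linearity in `p`. -/
theorem HasLaplaceIntegral.translationAction {d : ℕ} {f : EuclideanSpace ℝ (Fin d) → ℝ}
    {z : Fin d → ℂ} {c : ℂ} (hf : HasLaplaceIntegral f z c)
    (p : AddMonoidAlgebra ℝ (EuclideanSpace ℝ (Fin d))) :
    HasLaplaceIntegral (translationAction d p f) z (expCharacter z p * c) := by
  induction p using AddMonoidAlgebra.induction_linear with
  | zero => simpa using HasLaplaceIntegral.zero z
  | add p q hp hq => simpa [add_mul] using hp.add hq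
  | single u r =>
    have := (hf.translate u).smul r
    rw [expCharacter_single, mul_assoc]
    convert this using 1
    ext x
    simp [translationAction_single]

/-- The value at `z` of the Laplace transform of `f`, computed after applying a combination of
translations on which the character `e^{⟨z, ·⟩}` does not vanish. -/
def HasGeneralizedLaplace {d : ℕ} (f : EuclideanSpace ℝ (Fin d) → ℝ) (z : Fin d → ℂ) (c : ℂ) :
    Prop :=
  ∃ p : AddMonoidAlgebra ℝ (EuclideanSpace ℝ (Fin d)), expCharacter z p ≠ 0 ∧
    HasLaplaceIntegral (translationAction d p f) z (expCharacter z p * c)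

theorem HasLaplaceIntegral.hasGeneralizedLaplace {d : ℕ} {f : EuclideanSpace ℝ (Fin d) → ℝ}
    {z : Fin d → ℂ} {c : ℂ} (hf : HasLaplaceIntegral f z c) : HasGeneralizedLaplace f z c :=
  ⟨1, by simp, by simpa using hf⟩

namespace HasGeneralizedLaplace

variable {d : ℕ} {f g : EuclideanSpace ℝ (Fin d) → ℝ} {z : Fin d → ℂ} {a b : ℂ}

theorem congr_ae (hf : HasGeneralizedLaplace f z a) (h : g =ᵐ[volume] f) :
    HasGeneralizedLaplace g z a := by
  obtain ⟨p, hp, h1⟩ := hf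
  exact ⟨p, hp, h1.congr_ae (translationAction_congr_ae p h)⟩

/-- Applying `q` after `p` and `p` after `q` gives the same function, so its integral is `χ(p) χ(q)
a` and also `χ(p) χ(q) b`, where `χ` is the character at `z`. The factor `χ(p) χ(q)` is nonzero. -/
theorem unique (hf : HasGeneralizedLaplace f z a) (hg : HasGeneralizedLaplace f z b) : a = b := by
  obtain ⟨p, hp, h1⟩ := hf
  obtain ⟨q, hq, h2⟩ := hg
  have h3 := (h1.translationAction q).2
  have h4 := (h2.translationAction p).2
  rw [← Module.End.mul_apply, ← map_mul] at h3 h4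
  rw [mul_comm q p, h4] at h3
  have : expCharacter z p * expCharacter z q * b = expCharacter z p * expCharacter z q * a := by
    linear_combination h3
  exact (mul_left_cancel₀ (mul_ne_zero hp hq) this).symm

theorem zero : HasGeneralizedLaplace (0 : EuclideanSpace ℝ (Fin d) → ℝ) z 0 :=
  (HasLaplaceIntegral.zero z).hasGeneralizedLaplace

theorem add (hf : HasGeneralizedLaplace f z a) (hg : HasGeneralizedLaplace g z b) :
    HasGeneralizedLaplace (f + g) z (a + b) := by
  obtain ⟨p, hp, h1⟩ := hf
  obtain ⟨q, hq, h2⟩ := hg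
  -- `p * q` makes both integrals converge, and its character value is a product of nonzero numbers.
  refine ⟨p * q, by simp [hp, hq], ?_⟩
  have h3 := h1.translationAction q
  have h4 := h2.translationAction p
  rw [← Module.End.mul_apply, ← map_mul] at h3 h4
  rw [mul_comm q p] at h3
  rw [map_add]
  convert h3.add h4 using 1
  rw [map_mul]
  ring

theorem smul (hf : HasGeneralizedLaplace f z a) (r : ℝ) :
    HasGeneralizedLaplace (r • f) z (r * a) := by
  obtain ⟨p, hp, h1⟩ := hf
  refine ⟨p, hp, ?_⟩
  rw [map_smul]
  convert h1.smul r using 1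
  ring

theorem translate (hf : HasGeneralizedLaplace f z a) (u : EuclideanSpace ℝ (Fin d)) :
    HasGeneralizedLaplace (fun x => f (x - u)) z (Complex.exp (pairing z u) * a) := by
  obtain ⟨p, hp, h1⟩ := hf
  refine ⟨p, hp, ?_⟩
  have h2 : (fun x => f (x - u)) = translationAction d (AddMonoidAlgebra.single u 1) f := by
    ext x
    simp [translationAction_single]
  have h3 := h1.translationAction (AddMonoidAlgebra.single u 1)
  rw [← Module.End.mul_apply, ← map_mul, mul_comm, map_mul, Module.End.mul_apply, ← h2] at h3
  convert h3 using 1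
  rw [expCharacter_single]
  simp
  ring

theorem sum {ι : Type*} (s : Finset ι) {f : ι → EuclideanSpace ℝ (Fin d) → ℝ} {c : ι → ℂ}
    (hf : ∀ i ∈ s, HasGeneralizedLaplace (f i) z (c i)) :
    HasGeneralizedLaplace (∑ i ∈ s, f i) z (∑ i ∈ s, c i) := by
  classical
  induction s using Finset.induction_on with
  | empty => simpa using zero
  | insert i s hi ih =>
    rw [Finset.sum_insert hi, Finset.sum_insert hi]
    exact (hf i (Finset.mem_insert_self i s)).add
      (ih fun j hj => hf j (Finset.mem_insert_of_mem hj))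

end HasGeneralizedLaplace

/-! ### Parallelepipeds -/

/-- The half-open parallelepiped with corner `v` and edges `w_1, …, w_d`. -/
def parallelepipedAt {d : ℕ} (v : EuclideanSpace ℝ (Fin d))
    (w : Fin d → EuclideanSpace ℝ (Fin d)) : Set (EuclideanSpace ℝ (Fin d)) :=
  (fun c : EuclideanSpace ℝ (Fin d) =>
      v + Matrix.toLpLin 2 2 (Matrix.of fun i j => w j i) c) '' {c | ∀ j, c j ∈ Ico (0 : ℝ) 1}

theorem toLpLin_of_apply {d : ℕ} (w : Fin d → EuclideanSpace ℝ (Fin d))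
    (c : EuclideanSpace ℝ (Fin d)) :
    Matrix.toLpLin 2 2 (Matrix.of fun i j => w j i) c = ∑ j, c j • w j := by
  ext i
  simp [Matrix.mulVec, dotProduct, mul_comm]

theorem mem_parallelepipedAt_iff {d : ℕ} (v : EuclideanSpace ℝ (Fin d))
    {w : Fin d → EuclideanSpace ℝ (Fin d)} (hw : LinearIndependent ℝ w)
    (x : EuclideanSpace ℝ (Fin d)) :
    x ∈ parallelepipedAt v w ↔ ∀ j, (coneBasis hw).repr (x - v) j ∈ Ico (0 : ℝ) 1 := by
  constructor
  · rintro ⟨c, hc, rfl⟩ j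
    simp only [toLpLin_of_apply]
    rw [add_sub_cancel_left, coneBasis_repr_sum]
    exact hc j
  · intro h
    refine ⟨WithLp.toLp 2 ((coneBasis hw).repr (x - v)), h, ?_⟩
    simp only [toLpLin_of_apply]
    rw [sum_coneBasis_repr]
    abel

theorem measurableSet_unitCube {d : ℕ} :
    MeasurableSet {c : EuclideanSpace ℝ (Fin d) | ∀ j, c j ∈ Ico (0 : ℝ) 1} := by
  simp only [Set.ofPred_forall]
  refine MeasurableSet.iInter fun j => ?_
  exact measurableSet_Ico.preimage (by fun_prop : Measurable fun c : EuclideanSpace ℝ (Fin d) => c j)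

/-- In the coordinates given by the edges, the integral factors into one-dimensional integrals of
exponentials over the unit interval. -/
theorem integral_parallelepipedAt {d : ℕ} (v : EuclideanSpace ℝ (Fin d))
    {w : Fin d → EuclideanSpace ℝ (Fin d)} (hw : LinearIndependent ℝ w) {z : Fin d → ℂ}
    (hz : ∀ j, pairing z (w j) ≠ 0) :
    MeasurableSet (parallelepipedAt v w) ∧
    IntegrableOn (fun x => Complex.exp (pairing z x)) (parallelepipedAt v w) ∧
    ∫ x in parallelepipedAt v w, Complex.exp (pairing z x) =
      Complex.exp (pairing z v) * ((|Matrix.det (Matrix.of fun i j => w j i)| : ℝ) : ℂ) *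
        ∏ j, ((Complex.exp (pairing z (w j)) - 1) / pairing z (w j)) := by
  set M : Matrix (Fin d) (Fin d) ℝ := Matrix.of fun i j => w j i with hM
  set A : EuclideanSpace ℝ (Fin d) →L[ℝ] EuclideanSpace ℝ (Fin d) :=
    LinearMap.toContinuousLinearMap (Matrix.toLpLin 2 2 M) with hA
  have hdet : A.det = M.det := by
    rw [hA, ContinuousLinearMap.det]
    simp
  have hinj : Function.Injective A := by
    intro x y hxy
    have h0 : ∑ j, (x - y) j • w j = 0 := by
      rw [← toLpLin_of_apply]
      change A (x - y) = 0
      rw [map_sub, hxy, sub_self]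
    have := Fintype.linearIndependent_iff.1 hw _ h0
    ext j
    simpa [sub_eq_zero] using this j
  set S : Set (EuclideanSpace ℝ (Fin d)) := {c | ∀ j, c j ∈ Ico (0 : ℝ) 1} with hS
  have hSm : MeasurableSet S := measurableSet_unitCube
  have himg : parallelepipedAt v w = (fun c => v + A c) '' S := rfl
  have hf' : ∀ x ∈ S, HasFDerivWithinAt (fun c => v + A c) A S x :=
    fun x _ => (A.hasFDerivAt.const_add v).hasFDerivWithinAt
  have hfi : InjOn (fun c => v + A c) S := fun x _ y _ h => hinj (add_left_cancel h)
  set G : (Fin d → ℝ) → ℂ := fun c => ∏ j, Complex.exp (pairing z (w j) * (c j : ℂ)) with hG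
  have hexp : ∀ c : Fin d → ℝ, Complex.exp (pairing z (v + A (WithLp.toLp 2 c))) =
      Complex.exp (pairing z v) * G c := by
    intro c
    have := pairing_add_sum z v w c
    rw [show pairing z (v + A (WithLp.toLp 2 c)) = _ from this, Complex.exp_add,
      Complex.exp_sum]
  have hpre : (WithLp.toLp 2 : (Fin d → ℝ) → EuclideanSpace ℝ (Fin d)) ⁻¹' S =
      Set.univ.pi fun _ => Ico (0 : ℝ) 1 := by
    ext c
    simp [hS, Set.mem_pi]
  have hme := (MeasurableEquiv.toLp 2 (Fin d → ℝ)).measurableEmbedding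
  have hmp := PiLp.volume_preserving_toLp (Fin d)
  have hres : (volume : Measure (Fin d → ℝ)).restrict (Set.univ.pi fun _ => Ico (0 : ℝ) 1) =
      Measure.pi fun _ => (volume : Measure ℝ).restrict (Ioc 0 1) := by
    rw [volume_pi, Measure.restrict_pi_pi]
    simp_rw [Measure.restrict_congr_set (Ico_ae_eq_Ioc (a := (0 : ℝ)) (b := 1) (μ := volume))]
  have hGint : IntegrableOn G (Set.univ.pi fun _ => Ico (0 : ℝ) 1) := by
    rw [IntegrableOn, hres]
    refine Integrable.fintype_prod
      (f := fun j (t : ℝ) => Complex.exp (pairing z (w j) * (t : ℂ))) fun j => ?_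
    have hc : Continuous fun t : ℝ => Complex.exp (pairing z (w j) * (t : ℂ)) := by fun_prop
    exact hc.integrableOn_Ioc
  have hGval : ∫ c in Set.univ.pi fun _ => Ico (0 : ℝ) 1, G c =
      ∏ j, ((Complex.exp (pairing z (w j)) - 1) / pairing z (w j)) := by
    rw [hres, hG, integral_fintype_prod_eq_prod
      (f := fun j (t : ℝ) => Complex.exp (pairing z (w j) * (t : ℂ)))]
    refine Finset.prod_congr rfl fun j _ => ?_
    rw [← intervalIntegral.integral_of_le zero_le_one, integral_exp_mul_complex (hz j)]
    simp
  refine ⟨?_, ?_, ?_⟩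
  · rw [himg]
    exact hSm.image_of_continuousOn_injOn (by fun_prop) hfi
  · rw [himg, integrableOn_image_iff_integrableOn_abs_det_fderiv_smul volume hSm hf' hfi,
      ← hmp.integrableOn_comp_preimage hme, hpre]
    refine Integrable.smul _ ?_
    simp only [hexp]
    exact hGint.const_mul _
  · rw [himg, integral_image_eq_integral_abs_det_fderiv_smul volume hSm hf' hfi,
      ← hmp.setIntegral_preimage_emb hme, hpre]
    simp only [hexp, integral_smul, integral_const_mul, hGval, hdet]
    rw [Complex.real_smul]
    ring

theorem hasLaplaceIntegral_indicator {d : ℕ} {S : Set (EuclideanSpace ℝ (Fin d))}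
    (hS : MeasurableSet S) {z : Fin d → ℂ}
    (hi : IntegrableOn (fun x => Complex.exp (pairing z x)) S) :
    HasLaplaceIntegral (S.indicator fun _ => (1 : ℝ)) z
      (∫ x in S, Complex.exp (pairing z x)) := by
  have : (fun x => ((S.indicator (fun _ => (1 : ℝ)) x : ℝ) : ℂ) * Complex.exp (pairing z x)) =
      S.indicator fun x => Complex.exp (pairing z x) := by
    ext x
    by_cases h : x ∈ S <;> simp [h]
  rw [HasLaplaceIntegral, this, integral_indicator hS, integrable_indicator_iff hS]
  exact ⟨hi, rfl⟩

/-- Subtracting the translate by `w j` leaves the slab where coordinate `j` is less than 1.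
Half-open slabs make this a pointwise identity. -/
theorem translationAction_prod_simplicialCone {d : ℕ} (v : EuclideanSpace ℝ (Fin d))
    {w : Fin d → EuclideanSpace ℝ (Fin d)} (hw : LinearIndependent ℝ w) (s : Finset (Fin d)) :
    translationAction d (∏ j ∈ s, (1 - AddMonoidAlgebra.single (w j) 1))
      ((simplicialCone v w).indicator fun _ => (1 : ℝ)) =
    {x | ∀ j, 0 ≤ (coneBasis hw).repr (x - v) j ∧
      (j ∈ s → (coneBasis hw).repr (x - v) j < 1)}.indicator fun _ => (1 : ℝ) := by
  classical
  induction s using Finset.induction_on with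
  | empty =>
    ext x
    simp [indicator_apply, mem_simplicialCone_iff v hw]
  | insert i s hi ih =>
    rw [Finset.prod_insert hi, map_mul, Module.End.mul_apply, ih]
    ext x
    have h1 : ∀ j, (coneBasis hw).repr (x - w i - v) j =
        (coneBasis hw).repr (x - v) j - (if j = i then 1 else 0) := by
      intro j
      rw [show x - w i - v = (x - v) - w i by abel, map_sub, ← coneBasis_apply hw i,
        Module.Basis.repr_self, Finsupp.sub_apply, Finsupp.single_apply]
      simp [eq_comm]
    rw [map_sub, map_one, LinearMap.sub_apply, Module.End.one_apply, Pi.sub_apply,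
      translationAction_single, one_mul]
    obtain ⟨c, hc⟩ : ∃ c, c = (coneBasis hw).repr (x - v) := ⟨_, rfl⟩
    simp only [indicator_apply, mem_ofPred_eq, h1, ← hc]
    -- Translation by `w i` adds the condition `1 ≤ c i`. Since `i ∉ s`, there is no upper bound on
    -- `c i` to be shifted.
    have h2 : (∀ j, 0 ≤ c j - (if j = i then 1 else 0) ∧
        (j ∈ s → c j - (if j = i then 1 else 0) < 1)) ↔
        (∀ j, 0 ≤ c j ∧ (j ∈ s → c j < 1)) ∧ 1 ≤ c i := by
      constructor
      · intro h
        have h' : 1 ≤ c i := by simpa using (h i).1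
        refine ⟨fun j => ?_, h'⟩
        by_cases hj : j = i
        · subst hj; exact ⟨zero_le_one.trans h', fun hs => absurd hs hi⟩
        · simpa [hj] using h j
      · rintro ⟨h, h'⟩ j
        by_cases hj : j = i
        · subst hj; simpa [hi] using h'
        · simpa [hj] using h j
    have h3 : (∀ j, 0 ≤ c j ∧ (j ∈ insert i s → c j < 1)) ↔
        (∀ j, 0 ≤ c j ∧ (j ∈ s → c j < 1)) ∧ c i < 1 := by
      constructor
      · exact fun h => ⟨fun j => ⟨(h j).1, fun hj => (h j).2 (Finset.mem_insert_of_mem hj)⟩,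
          (h i).2 (Finset.mem_insert_self i s)⟩
      · rintro ⟨h, h'⟩ j
        refine ⟨(h j).1, fun hj => ?_⟩
        rcases Finset.mem_insert.1 hj with rfl | hj
        · exact h'
        · exact (h j).2 hj
    simp only [h2, h3]
    rcases lt_or_ge (c i) 1 with h | h
    · simp [h, h.not_ge]
    · simp [h, h.not_gt]

/-- The factors `1 - e^{⟨z, w_j⟩}` from the parallelepiped are exactly the character value of the
multiplier. No sign of `Re ⟨z, w_j⟩` is needed. -/
theorem hasGeneralizedLaplace_simplicialCone {d : ℕ} (v : EuclideanSpace ℝ (Fin d))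
    {w : Fin d → EuclideanSpace ℝ (Fin d)} (hw : LinearIndependent ℝ w) {z : Fin d → ℂ}
    (hz : ∀ j, Complex.exp (pairing z (w j)) ≠ 1) :
    HasGeneralizedLaplace ((simplicialCone v w).indicator fun _ => (1 : ℝ)) z
      (simplicialConeTransform v w z) := by
  have hz' : ∀ j, pairing z (w j) ≠ 0 := fun j h => hz j (by rw [h, Complex.exp_zero])
  have hχ : expCharacter z (∏ j, (1 - AddMonoidAlgebra.single (w j) 1)) =
      ∏ j, (1 - Complex.exp (pairing z (w j))) := by
    rw [map_prod]
    simp [expCharacter_single]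
  refine ⟨∏ j, (1 - AddMonoidAlgebra.single (w j) 1), ?_, ?_⟩
  · rw [hχ, Finset.prod_ne_zero_iff]
    exact fun j _ => sub_ne_zero.2 (hz j).symm
  · obtain ⟨h1, h2, h3⟩ := integral_parallelepipedAt v hw hz'
    have h4 := hasLaplaceIntegral_indicator h1 h2
    rw [translationAction_prod_simplicialCone v hw, hχ]
    convert h4 using 1
    · congr 1
      ext x
      simp [mem_parallelepipedAt_iff v hw, -map_sub]
    · have : ∏ j, ((Complex.exp (pairing z (w j)) - 1) / pairing z (w j)) =
          (∏ j, (1 - Complex.exp (pairing z (w j)))) / ∏ j, -pairing z (w j) := by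
        rw [← Finset.prod_div_distrib]
        refine Finset.prod_congr rfl fun j _ => ?_
        rw [← neg_sub, neg_div, div_neg]
      rw [h3, simplicialConeTransform, this]
      ring

/-! ### Uniqueness of the transform -/

/-- The exceptional set is the countable union of the null sets `⟨z, u⟩ = 2πin` with `n` an integer.
-/
theorem ae_exp_pairing_ne_one {d : ℕ} {u : EuclideanSpace ℝ (Fin d)} (hu : u ≠ 0) :
    ∀ᵐ z : Fin d → ℂ, Complex.exp (pairing z u) ≠ 1 := by
  let l : (Fin d → ℂ) →ₗ[ℝ] ℂ :=
    { toFun := fun z => pairing z u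
      map_add' := fun y z => by simp [pairing, add_mul, Finset.sum_add_distrib]
      map_smul' := fun r z => by simp [pairing, Finset.mul_sum, mul_assoc] }
  have hl : l ≠ 0 := by
    intro h
    refine hu ?_
    ext j
    have := congrArg (fun l => l (Pi.single j 1)) h
    simpa [l, pairing, Pi.single_apply] using this
  have : ∀ᵐ z : Fin d → ℂ, ∀ n : ℤ, pairing z u ≠ n * (2 * Real.pi * Complex.I) := by
    rw [ae_all_iff]
    intro n
    rw [ae_iff]
    simpa [l] using volume_setOf_linearMap_eq volume hl (n * (2 * Real.pi * Complex.I))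
  filter_upwards [this] with z hz
  rw [Ne, Complex.exp_eq_one_iff]
  push Not
  exact hz

/-- Ties a transform defined through a chosen representation to a value determined by `f` alone. -/
theorem HasFourierLaplaceTransform.ae_hasGeneralizedLaplace {d : ℕ}
    {f : EuclideanSpace ℝ (Fin d) → ℝ} {F : (Fin d → ℂ) → ℂ}
    (h : HasFourierLaplaceTransform f F) : ∀ᵐ z, HasGeneralizedLaplace f z (F z) := by
  obtain ⟨n, α, v, w, hw, hf, hF⟩ := h
  have hz : ∀ᵐ z : Fin d → ℂ, ∀ i j, Complex.exp (pairing z (w i j)) ≠ 1 :=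
    ae_all_iff.2 fun i => ae_all_iff.2 fun j => ae_exp_pairing_ne_one ((hw i).ne_zero j)
  filter_upwards [hF, hz] with z hFz hz
  rw [hFz]
  have h1 := HasGeneralizedLaplace.sum Finset.univ fun i _ =>
    (hasGeneralizedLaplace_simplicialCone (v i) (hw i) (hz i)).smul (α i)
  refine h1.congr_ae (hf.trans (Filter.Eventually.of_forall fun x => ?_))
  simp

theorem HasFourierLaplaceTransform.ae_unique {d : ℕ}
    {f : EuclideanSpace ℝ (Fin d) → ℝ} {F G : (Fin d → ℂ) → ℂ}
    (hF : HasFourierLaplaceTransform f F) (hG : HasFourierLaplaceTransform f G) :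
    F =ᵐ[volume] G := by
  filter_upwards [hF.ae_hasGeneralizedLaplace, hG.ae_hasGeneralizedLaplace] with z h1 h2
  exact h1.unique h2

/-! ### Line-cones have zero transform -/

/-- Invariance under translation by `u` gives `F z = e^{⟨z, u⟩} F z`, which forces `F z = 0`
wherever the exponential is not 1. -/
theorem IsLineCone.ae_hasGeneralizedLaplace_zero {d : ℕ} {D : Set (EuclideanSpace ℝ (Fin d))}
    (hD : IsLineCone D) :
    ∀ᵐ z, HasGeneralizedLaplace (D.indicator fun _ => (1 : ℝ)) z 0 := by
  obtain ⟨F, hF⟩ := hD.exists_hasFourierLaplaceTransform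
  obtain ⟨-, -, u, hu, hDu⟩ := hD
  have hinv : (fun x => D.indicator (fun _ => (1 : ℝ)) (x - u)) =
      D.indicator fun _ => (1 : ℝ) := by
    classical
    ext x
    have : x - u ∈ D ↔ x ∈ D := by
      constructor
      · intro h
        simpa using hDu _ h 1
      · intro h
        simpa [sub_eq_add_neg] using hDu _ h (-1)
    simp [indicator_apply, this]
  filter_upwards [hF.ae_hasGeneralizedLaplace, ae_exp_pairing_ne_one hu] with z h1 h2
  have h3 := h1.translate u
  rw [hinv] at h3
  have h4 := h1.unique h3
  have h5 : (Complex.exp (pairing z u) - 1) * F z = 0 := by linear_combination -h4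
  rw [(mul_eq_zero.1 h5).resolve_left (sub_ne_zero.2 h2)] at h1
  exact h1

theorem IsLineConeCombination.ae_hasGeneralizedLaplace_zero {d : ℕ}
    {f : EuclideanSpace ℝ (Fin d) → ℝ} (hf : IsLineConeCombination f) :
    ∀ᵐ z, HasGeneralizedLaplace f z 0 := by
  obtain ⟨n, α, D, hD, hf⟩ := hf
  filter_upwards [ae_all_iff.2 fun i => (hD i).ae_hasGeneralizedLaplace_zero] with z hz
  have h1 := HasGeneralizedLaplace.sum Finset.univ fun i _ => (hz i).smul (α i)
  simp only [mul_zero, Finset.sum_const_zero] at h1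
  refine h1.congr_ae (hf.trans (Filter.Eventually.of_forall fun x => ?_))
  simp

/-! ### Functions with zero transform -/

/-- The positive and negative parts of `h` are densities of two finite measures with equal
characteristic functions. The measures therefore coincide, and so do the densities. -/
theorem ae_eq_zero_of_forall_integral_mul_exp_inner_eq_zero {E : Type*} [NormedAddCommGroup E]
    [InnerProductSpace ℝ E] [MeasurableSpace E] [BorelSpace E] [SecondCountableTopology E]
    [CompleteSpace E] {μ : Measure E} {h : E → ℝ} (hi : Integrable h μ)
    (h0 : ∀ η : E, ∫ x, (h x : ℂ) * Complex.exp (inner ℝ x η * Complex.I) ∂μ = 0) :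
    h =ᵐ[μ] 0 := by
  have hm : AEMeasurable h μ := hi.aestronglyMeasurable.aemeasurable
  have hfin1 := isFiniteMeasure_withDensity_ofReal hi.hasFiniteIntegral
  have hfin2 := isFiniteMeasure_withDensity_ofReal hi.neg.hasFiniteIntegral
  have hexp : ∀ η : E, AEStronglyMeasurable
      (fun x => Complex.exp (inner ℝ x η * Complex.I)) μ := fun η =>
    (by fun_prop : Continuous fun x : E =>
      Complex.exp (inner ℝ x η * Complex.I)).aestronglyMeasurable
  have hint : ∀ (g : E → ℝ), Integrable g μ → ∀ η : E,
      Integrable (fun x => g x • Complex.exp (inner ℝ x η * Complex.I)) μ := by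
    intro g hg η
    refine hg.smul_bdd 1 (hexp η) (Filter.Eventually.of_forall fun x => ?_)
    rw [Complex.norm_exp_ofReal_mul_I]
  have heq : μ.withDensity (fun x => ENNReal.ofReal (h x)) =
      μ.withDensity (fun x => ENNReal.ofReal ((-h) x)) := by
    apply Measure.ext_of_charFun
    ext η
    rw [charFun_apply, charFun_apply,
      integral_withDensity_eq_integral_toReal_smul₀ hm.ennreal_ofReal (by simp),
      integral_withDensity_eq_integral_toReal_smul₀ hm.neg.ennreal_ofReal (by simp),
      ← sub_eq_zero, ← integral_sub (hint _ (by simpa [ENNReal.toReal_ofReal'] using hi.pos_part) η)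
        (hint _ (by simpa [ENNReal.toReal_ofReal'] using hi.neg_part) η), ← h0 η]
    refine integral_congr_ae (Filter.Eventually.of_forall fun x => ?_)
    simp only [← sub_smul, Pi.neg_apply, ENNReal.toReal_ofReal']
    rw [max_zero_sub_max_neg_zero_eq_self, Complex.real_smul]
  rw [withDensity_eq_iff hm.ennreal_ofReal hm.neg.ennreal_ofReal hi.lintegral_lt_top.ne] at heq
  filter_upwards [heq] with x hx
  have := congrArg ENNReal.toReal hx
  simp only [ENNReal.toReal_ofReal', Pi.neg_apply] at this
  rw [← sub_eq_zero, max_zero_sub_max_neg_zero_eq_self] at this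
  exact this

theorem continuous_pairing {d : ℕ} (x : EuclideanSpace ℝ (Fin d)) :
    Continuous fun z : Fin d → ℂ => pairing z x := by
  unfold pairing
  fun_prop

theorem continuousOn_simplicialConeTransform {d : ℕ} (v : EuclideanSpace ℝ (Fin d))
    (w : Fin d → EuclideanSpace ℝ (Fin d)) :
    ContinuousOn (simplicialConeTransform v w) {z | ∀ j, (pairing z (w j)).re < 0} := by
  unfold simplicialConeTransform
  refine ContinuousOn.div ?_ ?_ ?_
  · exact ((Complex.continuous_exp.comp (continuous_pairing v)).mul
      continuous_const).continuousOn
  · exact (continuous_finsetProd _ fun j _ => (continuous_pairing (w j)).neg).continuousOn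
  · intro z hz
    rw [Finset.prod_ne_zero_iff]
    intro j _ h
    have := hz j
    rw [neg_eq_zero.1 h] at this
    simp at this

theorem measurableSet_simplicialCone {d : ℕ} (v : EuclideanSpace ℝ (Fin d))
    {w : Fin d → EuclideanSpace ℝ (Fin d)} (hw : LinearIndependent ℝ w) :
    MeasurableSet (simplicialCone v w) := by
  have : simplicialCone v w = ⋂ j, {x | 0 ≤ (coneBasis hw).coord j (x - v)} := by
    ext x
    simp [mem_simplicialCone_iff v hw, -map_sub]
  rw [this]
  refine MeasurableSet.iInter fun j => (isClosed_le continuous_const ?_).measurableSet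
  exact (LinearMap.continuous_of_finiteDimensional _).comp (continuous_id.sub continuous_const)

/-- The point `ξ + i η` of `ℂ^d`. -/
noncomputable def complexPoint {d : ℕ} (ξ η : EuclideanSpace ℝ (Fin d)) : Fin d → ℂ :=
  fun j => ξ j + η j * Complex.I

theorem pairing_complexPoint {d : ℕ} (ξ η x : EuclideanSpace ℝ (Fin d)) :
    pairing (complexPoint ξ η) x =
      ((inner ℝ ξ x : ℝ) : ℂ) + ((inner ℝ x η : ℝ) : ℂ) * Complex.I := by
  simp only [pairing, complexPoint, add_mul, Finset.sum_add_distrib, PiLp.inner_apply,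
    RCLike.inner_apply, conj_trivial, Complex.ofReal_sum, Complex.ofReal_mul, Finset.sum_mul]
  congr 1
  · exact Finset.sum_congr rfl fun j _ => by ring
  · exact Finset.sum_congr rfl fun j _ => by ring

theorem exists_forall_inner_ne_zero {d : ℕ} {ι : Type*} [Finite ι]
    (u : ι → EuclideanSpace ℝ (Fin d)) (hu : ∀ i, u i ≠ 0) :
    ∃ ξ : EuclideanSpace ℝ (Fin d), ∀ i, inner ℝ ξ (u i) ≠ 0 := by
  obtain ⟨l, hl⟩ := Module.exists_dual_forall_apply_ne_zero (K := ℝ) u hu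
  refine ⟨(InnerProductSpace.toDual ℝ _).symm (LinearMap.toContinuousLinearMap l), fun i => ?_⟩
  rw [InnerProductSpace.toDual_symm_apply]
  exact hl i

/-- Because all generators lie in one open half-space, the integrals converge on a common open set
`U` containing `ξ + iℝ^d`. There the vanishing transform is the Fourier transform of `h(x) e^{⟨ξ,
x⟩}`. -/
theorem ae_eq_zero_of_ae_hasGeneralizedLaplace_zero {d : ℕ} {ι : Type*} [Fintype ι]
    (β : ι → ℝ) (v : ι → EuclideanSpace ℝ (Fin d)) (w : ι → Fin d → EuclideanSpace ℝ (Fin d))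
    (hw : ∀ i, LinearIndependent ℝ (w i)) (ξ : EuclideanSpace ℝ (Fin d))
    (hξ : ∀ i j, inner ℝ ξ (w i j) < 0)
    (h0 : ∀ᵐ z, HasGeneralizedLaplace
      (∑ i, β i • (simplicialCone (v i) (w i)).indicator fun _ => (1 : ℝ)) z 0) :
    ∑ i, β i • (simplicialCone (v i) (w i)).indicator (fun _ => (1 : ℝ)) =ᵐ[volume] 0 := by
  set h := ∑ i, β i • (simplicialCone (v i) (w i)).indicator fun _ => (1 : ℝ) with hh
  set U : Set (Fin d → ℂ) := {z | ∀ i j, (pairing z (w i j)).re < 0} with hU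
  have hUo : IsOpen U := by
    simp only [hU, Set.ofPred_forall]
    exact isOpen_iInter_of_finite fun i => isOpen_iInter_of_finite fun j =>
      isOpen_lt (Complex.continuous_re.comp (continuous_pairing _)) continuous_const
  set G : (Fin d → ℂ) → ℂ := fun z => ∑ i, (β i : ℂ) * simplicialConeTransform (v i) (w i) z
    with hG
  have hGc : ContinuousOn G U := by
    refine continuousOn_finsetSum _ fun i _ => continuousOn_const.mul ?_
    exact (continuousOn_simplicialConeTransform (v i) (w i)).mono fun z hz j => hz i j
  have hLap : ∀ z ∈ U, HasLaplaceIntegral h z (G z) := by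
    intro z hz
    refine HasLaplaceIntegral.sum Finset.univ fun i _ => HasLaplaceIntegral.smul ?_ (β i)
    rw [← integral_simplicialCone (v i) (hw i) z (hz i)]
    exact hasLaplaceIntegral_indicator (measurableSet_simplicialCone (v i) (hw i))
      (integrableOn_simplicialCone (v i) (hw i) z (hz i))
  -- Vanishing almost everywhere does not suffice, since the slice `ξ + iℝ^d` is null for `d > 0`;
  -- continuity gives vanishing at every point of `U`.
  have hG0 : EqOn G 0 U := by
    refine Measure.eqOn_open_of_ae_eq (μ := volume) ?_ hUo hGc continuousOn_const
    rw [Filter.EventuallyEq, ae_restrict_iff' hUo.measurableSet]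
    filter_upwards [h0] with z hz hzU
    exact (hLap z hzU).hasGeneralizedLaplace.unique hz
  have hmem : ∀ η, complexPoint ξ η ∈ U := by
    intro η i j
    rw [pairing_complexPoint]
    simpa using hξ i j
  have hexp : ∀ η x, (h x : ℂ) * Complex.exp (pairing (complexPoint ξ η) x) =
      ((h x * Real.exp (inner ℝ ξ x) : ℝ) : ℂ) * Complex.exp (inner ℝ x η * Complex.I) := by
    intro η x
    rw [pairing_complexPoint, Complex.exp_add]
    push_cast
    ring
  have hint : Integrable fun x => h x * Real.exp (inner ℝ ξ x) := by
    -- At `η = 0` the exponential is real and the absolutely convergent integrand is the weighted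
    -- function itself.
    have := (hLap _ (hmem 0)).1
    simp only [hexp, inner_zero_right, Complex.ofReal_zero, zero_mul, Complex.exp_zero,
      mul_one] at this
    exact this.re
  have := ae_eq_zero_of_forall_integral_mul_exp_inner_eq_zero hint fun η => by
    have h1 := (hLap _ (hmem η)).2
    simp only [hexp] at h1
    rw [h1]
    exact hG0 (hmem η)
  filter_upwards [this] with x hx
  exact (mul_eq_zero.1 hx).resolve_right (Real.exp_pos _).ne'

/-- For the forward direction, `f` splits into a line-cone combination and a combination `h` of
cones in one half-space. Line-cones do not contribute to the transform, so that of `h` vanishes too,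
and hence `h` does. -/
theorem HasFourierLaplaceTransform.ae_eq_zero_iff {d : ℕ}
    {f : EuclideanSpace ℝ (Fin d) → ℝ} {F : (Fin d → ℂ) → ℂ}
    (hF : HasFourierLaplaceTransform f F) : F =ᵐ[volume] 0 ↔ IsLineConeCombination f := by
  have hL := hF.ae_hasGeneralizedLaplace
  constructor
  · intro h0
    obtain ⟨n, α, v, w, hw, hf, -⟩ := hF
    obtain ⟨ξ, hξ⟩ := exists_forall_inner_ne_zero (fun k : Fin n × Fin d => w k.1 k.2)
      fun k => (hw k.1).ne_zero k.2
    choose ε w' hw' hξ' hLC using fun i =>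
      exists_simplicialCone_sub_isLineConeCombination ξ (v i) (hw i) fun j => hξ (i, j)
    set h := ∑ i, (α i * ε i) • (simplicialCone (v i) (w' i)).indicator fun _ => (1 : ℝ) with hh
    have hsub : IsLineConeCombination (f - h) := by
      refine (IsLineConeCombination.sum Finset.univ fun i _ => (hLC i).smul (α i)).congr_ae ?_
      filter_upwards [hf] with x hx
      simp [hx, hh, mul_sub, mul_assoc]
    have hh0 : h =ᵐ[volume] 0 := by
      refine ae_eq_zero_of_ae_hasGeneralizedLaplace_zero _ v w' hw' ξ hξ' ?_
      filter_upwards [hL, h0, hsub.ae_hasGeneralizedLaplace_zero] with z h1 h2 h3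
      rw [h2] at h1
      -- Computes the value of `h` as that of `f - (f - h)`.
      have h4 := h1.add (h3.smul (-1))
      simp only [Pi.zero_apply, mul_zero, add_zero] at h4
      refine h4.congr_ae (Filter.Eventually.of_forall fun x => ?_)
      simp [hh]
    refine hsub.congr_ae ?_
    filter_upwards [hh0] with x hx
    simp [hx]
  · intro hf
    filter_upwards [hL, hf.ae_hasGeneralizedLaplace_zero] with z h1 h2
    exact h1.unique h2

/-! ### The main theorem -/

theorem mainTheorem4 (d : ℕ) :
    (∀ g : EuclideanSpace ℝ (Fin d) → ℝ, IsPolyconical g →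
      ∃ F : (Fin d → ℂ) → ℂ, HasFourierLaplaceTransform g F ∧
        (∀ F' : (Fin d → ℂ) → ℂ, HasFourierLaplaceTransform g F' → F' =ᵐ[volume] F) ∧
        (F =ᵐ[volume] 0 ↔ IsLineConeCombination g)) ∧
    (∀ P : Set (EuclideanSpace ℝ (Fin d)), IsGeneralizedPolyhedron P →
      ∀ v : EuclideanSpace ℝ (Fin d),
      ∃ F : (Fin d → ℂ) → ℂ,
        HasFourierLaplaceTransform ((tangentCone P v).indicator (fun _ => (1 : ℝ))) F ∧
        (∀ F' : (Fin d → ℂ) → ℂ,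
          HasFourierLaplaceTransform ((tangentCone P v).indicator (fun _ => (1 : ℝ))) F' →
          F' =ᵐ[volume] F) ∧
        (IsAlgebraicVertex P v ↔ ¬ F =ᵐ[volume] 0)) := by
  constructor
  · rintro g ⟨n, α, w, hw, hg⟩
    have hF : HasFourierLaplaceTransform g _ :=
      ⟨n, α, fun _ => 0, w, hw, hg, Filter.EventuallyEq.rfl⟩
    exact ⟨_, hF, fun F' hF' => hF'.ae_unique hF, hF.ae_eq_zero_iff⟩
  · intro P hP v
    obtain ⟨F, hF⟩ := exists_hasFourierLaplaceTransform_of_mem_coneSpan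
      (hP.tangentCone_indicator_mem_coneSpan v)
    refine ⟨F, hF, fun F' hF' => hF'.ae_unique hF, ?_⟩
    rw [hF.ae_eq_zero_iff, IsAlgebraicVertex, and_iff_right_iff_imp]
    intro h
    -- Membership of `v` in `P` is automatic: otherwise the parameter `t = 0` shows the tangent cone
    -- to be empty, and its indicator is the empty combination.
    by_contra hv
    refine h ?_
    have : tangentCone P v = ∅ := by
      rw [eq_empty_iff_forall_notMem]
      rintro y ⟨ε, hε, hy⟩
      exact hv (by simpa using hy 0 ⟨le_rfl, hε.le⟩)
    rw [this, indicator_empty]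
    exact IsLineConeCombination.zero
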